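/- Let $d,L\ge 1$ and $k,K,z\ge 0$ be integers, $\hbar>0$, $T\ge 0$, $|h|\ge 0$ and $\varepsilon>0$. Consider a lattice of $L$ qudits with Hilbert space $(\mathbb C^d)^{\otimes L}$, and let $\|\cdot\|$ be the operator norm. Consider all time-dependent Hamiltonians $H(t)=\sum_{i=1}^K h_i(t)$, $0\le t\le T$, with Hermitian terms that depend (measurably) on time and are such that - each $h_i(t)$ acts nontrivially only on a set of at most $k$ sites, which does not depend on $t$; - $\max_i\sup_{0\le t\le T}\|h_i(t)\|/\hbar\le |h|$; - for every $i$ and all times $t,s\in[0,T]$, the commutator $[h_i(t),h_j(s)]$ is nonzero for at most $z$ indices $j$. Let $U(t)$ be the time-evolution operator, $i\hbar\,\partial_tU(t)=H(t)U(t)$, $U(0)=1$ (in integrated form if $H$ is not continuous). Let $O=O^\dagger$ be an observable with spectral width $w(O)=(\omega_{\max}-\omega_{\min})/2$, half the difference of its largest and smallest eigenvalues. Then the following hold for the set of all evolved observables $U(T)^\dagger\,O\,U(T)$ with Hamiltonians as above (with all choices of the supports). 1. If $4T^2Kz|h|^2/\varepsilon\ge 1$ and $112\,T^2K^2z|h|^2/\varepsilon^2\ge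 1$, then they are contained in at most $$L^{kK}\left(\frac{112\,T^2K^2z|h|^2}{\varepsilon^2}\right)^{4d^{2k}T^2K^2z|h|^2/\varepsilon}$$ balls of radius $\varepsilon\,w(O)$ in operator space. 2. The number in 1 is $L^{kK}e^{\mathcal O(T^2K^2z\ln(T^2K^2z))}$: there is a constant $C>0$ that depends only on $d,k,|h|,\varepsilon$ such that it is at most $L^{kK}\exp\left(C\,T^2K^2z\ln(T^2K^2z)\right)$ whenever $T^2K^2z\ge 2$. 3. If $4T^2Kz|h|^2/\varepsilon<1$ and $\varepsilon\le 28K$, then they are contained in at most $L^{kK}(28K/\varepsilon)^{d^{2k}K}$ balls of radius $\varepsilon\,w(O)$. 4. For every integer $N\ge 1$ and $\Delta t=T/N$, the product $U^{\Delta t}(T)=\prod_{n=1}^{N}\prod_{i=1}^K u_i(n)$ (later time steps to the left), where $u_i(n)$ is the time-evolution operator from time $(n-1)\Delta t$ to $n\Delta t$ generated by $h_i(t)$, satisfies $\|U^{\Delta t}(T)-U(T)\|\le \Delta t\,T\,K\,z\,|h|^2$. -/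

import Mathlib

open scoped Matrix Matrix.Norms.L2Operator

/-- Operators on the Hilbert space `(ℂ^d)^{⊗ L}` of `L` qudits, as matrices in the product basis,
which is indexed by the configurations `Fin L → Fin d`. The norm on them is the operator norm
(the matrix norm induced by the Euclidean norm). -/
abbrev QuditOp (d L : ℕ) : Type :=
  Matrix (Fin L → Fin d) (Fin L → Fin d) ℂ

/-- `A` acts only on the sites in `S`: it is `B ⊗ 1` with an operator `B` on the qudits of `S` and
the identity on all the other qudits. -/
def ActsOn {d L : ℕ} (S : Finset (Fin L)) (A : QuditOp d L) : Prop :=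
  ∃ B : Matrix (S → Fin d) (S → Fin d) ℂ, ∀ σ τ : Fin L → Fin d,
    ((∀ x, x ∉ S → σ x = τ x) → A σ τ = B (fun x => σ x) (fun x => τ x)) ∧
    ((¬ ∀ x, x ∉ S → σ x = τ x) → A σ τ = 0)

/-- The spectral width: half the difference of the maximum and the minimum eigenvalue. -/
noncomputable def spectralWidth {d L : ℕ} (O : QuditOp d L) : ℝ :=
  (sSup (spectrum ℝ O) - sInf (spectrum ℝ O)) / 2

/-- `U` is the time-evolution operator that starts at time `a` and is generated by `H` on `[a, b]`:
`i ħ ∂ₜ U(t) = H(t) U(t)` and `U(a) = 1`. The equation is integrated over time, so that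
discontinuous (bounded and measurable) `H` are covered. -/
def IsEvolution {d L : ℕ} (hbar : ℝ) (H : ℝ → QuditOp d L) (a b : ℝ) (U : ℝ → QuditOp d L) :
    Prop :=
  ContinuousOn U (Set.Icc a b) ∧
    ∀ t ∈ Set.Icc a b, U t = 1 + ∫ s in a..t, (-Complex.I / (hbar : ℂ)) • (H s * U s)

/-- The terms `h i`, `i = 1, …, K`, of a time-dependent Hamiltonian `∑ i, h i t` on `[0, T]`:
they are Hermitian and depend measurably on time, each acts on at most `k` sites (which do not
depend on time), `‖h i t‖ / ħ ≤ η`, and each term fails to commute with at most `z` terms. -/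
structure IsAdmissible {d L K : ℕ} (k z : ℕ) (hbar η T : ℝ) (h : Fin K → ℝ → QuditOp d L) :
    Prop where
  measurable : ∀ i, MeasureTheory.AEStronglyMeasurable (h i)
    (MeasureTheory.volume.restrict (Set.Icc 0 T))
  hermitian : ∀ i, ∀ t ∈ Set.Icc 0 T, (h i t).IsHermitian
  klocal : ∀ i, ∃ S : Finset (Fin L), S.card ≤ k ∧ ∀ t ∈ Set.Icc 0 T, ActsOn S (h i t)
  bounded : ∀ i, ∀ t ∈ Set.Icc 0 T, ‖h i t‖ / hbar ≤ η
  commute : ∀ i, ∀ t ∈ Set.Icc 0 T, ∀ s ∈ Set.Icc 0 T,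
    {j : Fin K | ¬ Commute (h i t) (h j s)}.ncard ≤ z

/-- The observables `U(T)† O U(T)` that are obtained from `O` by evolution from time `0` to `T`
with a Hamiltonian that has `K` terms as in `IsAdmissible`. -/
def evolvedObservables {d L : ℕ} (K k z : ℕ) (hbar η T : ℝ) (O : QuditOp d L) :
    Set (QuditOp d L) :=
  {A | ∃ (h : Fin K → ℝ → QuditOp d L) (U : ℝ → QuditOp d L),
    IsAdmissible k z hbar η T h ∧ IsEvolution hbar (fun t => ∑ i, h i t) 0 T U ∧
      A = (U T)ᴴ * O * U T}

/-- `X` is contained in the union of at most `B` (closed) balls of radius `r` in operator space. -/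
def CoveredByBalls {d L : ℕ} (X : Set (QuditOp d L)) (r B : ℝ) : Prop :=
  ∃ Q : Finset (QuditOp d L), (Q.card : ℝ) ≤ B ∧ ∀ A ∈ X, ∃ C ∈ Q, ‖A - C‖ ≤ r

/-- The time-ordered product of time steps, later steps standing to the left, in which the step
number `n` is the product of the factors `u 0 n`, `u 1 n`, …, `u (K - 1) n` in this order. -/
def trotterProduct {d L K N : ℕ} (u : Fin K → Fin N → QuditOp d L) : QuditOp d L :=
  (List.ofFn fun n : Fin N => (List.ofFn fun i : Fin K => u i n.rev).prod).prod

/-! The evolved observables are approximated by finitely many operators in two stages: a Trotter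
product replaces `U T`, and every factor of the product is then rounded to a finite net.

Trotter error. Let `P = u_0 u_1 ⋯` be the product of the evolutions under the single terms within
one time step. Its derivative differs from `(∑ G_i) P` only because each `G_j` must be moved to the
left past the `u_i` with `i < j`, so the defect is at most `∑_{i<j} ‖[G_j, u_i]‖`
(`isPrimitiveOn_list_prod`). A commutator with `u_i` is at most the time integral of the commutator
with `G_i` (`norm_commutator_le_integral`), and at each pair of times a term has at most `z`
noncommuting partners, which bounds the sum over all pairs by `2 K z η² (t - a)`
(`sum_norm_commutator_le`). The reversed ordering of the factors sees exactly the complementary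
pairs `j < i`, hence the errors of the two orderings add up to at most `K z η² Δt²` per step
(`norm_step_add_norm_step_rev_le`). Unitarity makes the step errors merely add up over time.
Dropping one of the two orderings gives the stated Trotter bound; choosing the better one gains a
factor 2, which the covering numbers use.

Counting. Each factor is a unitary on at most `k` sites. Such unitaries are `exp (i x)` with `x`
self-adjoint and `‖x‖ ≤ π`, in a real space of dimension at most `d ^ (2 k)`. Since `x ↦ exp (i x)`
is 1-Lipschitz, a volumetric net for the ball of radius `π` yields a net for the unitaries
(`exists_net_unitary`). The `K` supports contribute at most `L ^ (k K)` choices, and the `K N`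
factors contribute the power of the net size. Subtracting the midpoint of the spectrum from `O`,
which commutes with the evolution, reduces its norm to the spectral width, so an error `ε / 2` in
the unitary suffices. The rest is the choice of the number `N` of steps and of the net accuracy `δ`.

The Hamiltonian is only measurable in time, so derivatives are replaced throughout by indefinite
integrals (`IsPrimitiveOn`), with a product rule of their own. -/

open MeasureTheory Set

/-! ### Calculus of indefinite integrals of bounded measurable functions -/

/-- A function whose increments are quadratically small is constant. -/
theorem eq_of_norm_sub_le_sq {E : Type*} [NormedAddCommGroup E] [NormedSpace ℝ E] {D : ℝ → E}
    {a b c : ℝ} (h : ∀ s ∈ Icc a b, ∀ t ∈ Icc a b, s ≤ t → ‖D t - D s‖ ≤ c * (t - s) ^ 2) :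
    ∀ t ∈ Icc a b, D t = D a := by
  have key : ∀ x ∈ Icc a b, (fun y => D y - D x) =O[nhdsWithin x (Icc a b)]
      fun y => (y - x) ^ 2 := by
    intro x hx
    refine Asymptotics.IsBigO.of_bound c ?_
    filter_upwards [self_mem_nhdsWithin] with y hy
    rw [norm_pow, Real.norm_eq_abs, sq_abs]
    rcases le_total x y with hxy | hxy
    · exact h x hx y hy hxy
    · rw [norm_sub_rev, ← neg_sub x y, neg_sq]
      exact h y hy x hx hxy
  have small : ∀ x : ℝ, (fun y : ℝ => (y - x) ^ 2) =o[nhds x] fun y => y - x := by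
    intro x
    have h1 : (fun y : ℝ => y - x) =o[nhds x] fun _ => (1 : ℝ) := by
      rw [Asymptotics.isLittleO_one_iff]
      exact (continuous_id.sub continuous_const).tendsto' x 0 (by simp)
    simpa [sq] using h1.mul_isBigO (Asymptotics.isBigO_refl (fun y : ℝ => y - x) (nhds x))
  have der : ∀ x ∈ Icc a b, HasDerivWithinAt D 0 (Icc a b) x := by
    intro x hx
    rw [hasDerivWithinAt_iff_isLittleO]
    simpa using (key x hx).trans_isLittleO ((small x).mono nhdsWithin_le_nhds)
  refine constant_of_has_deriv_right_zero (fun x hx => (der x hx).continuousWithinAt) ?_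
  intro x hx
  refine ((der x (Ico_subset_Icc_self hx)).mono (Icc_subset_Icc_left hx.1)).mono_of_mem_nhdsWithin ?_
  exact Icc_mem_nhdsGE hx.2

/-- On `[a, b]`, the function `F` is an indefinite integral of the bounded measurable function
`f`. -/
structure IsPrimitiveOn {E : Type*} [NormedAddCommGroup E] [NormedSpace ℝ E] (a b : ℝ)
    (F f : ℝ → E) : Prop where
  measurable : AEStronglyMeasurable f (volume.restrict (Icc a b))
  bounded : ∃ c, ∀ t ∈ Icc a b, ‖f t‖ ≤ c
  eq_add_integral : ∀ t ∈ Icc a b, F t = F a + ∫ s in a..t, f s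

theorem intervalIntegrable_of_bounded {E : Type*} [NormedAddCommGroup E]
    {a b c : ℝ} {f : ℝ → E} (hm : AEStronglyMeasurable f (volume.restrict (Icc a b)))
    (hc : ∀ t ∈ Icc a b, ‖f t‖ ≤ c) {s t : ℝ} (hs : s ∈ Icc a b) (ht : t ∈ Icc a b) :
    IntervalIntegrable f volume s t := by
  rw [intervalIntegrable_iff]
  have hsub : uIoc s t ⊆ Icc a b := uIoc_subset_uIcc.trans (uIcc_subset_Icc hs ht)
  refine IntegrableOn.mono_set (t := Icc a b) ?_ hsub
  exact Integrable.of_bound hm c ((ae_restrict_mem measurableSet_Icc).mono fun x hx => hc x hx)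

namespace IsPrimitiveOn

section Space

variable {E : Type*} [NormedAddCommGroup E] [NormedSpace ℝ E] {a b : ℝ} {F f : ℝ → E}

theorem intervalIntegrable (h : IsPrimitiveOn a b F f) {s t : ℝ} (hs : s ∈ Icc a b)
    (ht : t ∈ Icc a b) : IntervalIntegrable f volume s t :=
  let ⟨_, hc⟩ := h.bounded
  intervalIntegrable_of_bounded h.measurable hc hs ht

theorem sub_eq (h : IsPrimitiveOn a b F f) {s t : ℝ} (hs : s ∈ Icc a b) (ht : t ∈ Icc a b) :
    F t - F s = ∫ r in s..t, f r := by
  have ha : a ∈ Icc a b := ⟨le_rfl, hs.1.trans hs.2⟩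
  rw [h.eq_add_integral t ht, h.eq_add_integral s hs, add_sub_add_left_eq_sub,
    intervalIntegral.integral_interval_sub_left (h.intervalIntegrable ha ht)
      (h.intervalIntegrable ha hs)]

theorem norm_sub_le_integral (h : IsPrimitiveOn a b F f) {s t : ℝ} (hs : s ∈ Icc a b)
    (ht : t ∈ Icc a b) (hst : s ≤ t) {g : ℝ → ℝ} (hg : IntervalIntegrable g volume s t)
    (hfg : ∀ r ∈ Icc s t, ‖f r‖ ≤ g r) : ‖F t - F s‖ ≤ ∫ r in s..t, g r := by
  rw [h.sub_eq hs ht]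
  refine intervalIntegral.norm_integral_le_of_norm_le hst ?_ hg
  exact Filter.Eventually.of_forall fun r hr => hfg r ⟨hr.1.le, hr.2⟩

theorem norm_sub_le (h : IsPrimitiveOn a b F f) {c : ℝ} (hc : ∀ t ∈ Icc a b, ‖f t‖ ≤ c) {s t : ℝ}
    (hs : s ∈ Icc a b) (ht : t ∈ Icc a b) (hst : s ≤ t) : ‖F t - F s‖ ≤ c * (t - s) := by
  have := h.norm_sub_le_integral hs ht hst (g := fun _ => c) (by simp)
    fun r hr => hc r ⟨hs.1.trans hr.1, hr.2.trans ht.2⟩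
  simpa [mul_comm] using this

theorem continuousOn (h : IsPrimitiveOn a b F f) : ContinuousOn F (Icc a b) := by
  obtain ⟨c, hc⟩ := h.bounded
  have hL : LipschitzOnWith c.toNNReal F (Icc a b) := by
    refine LipschitzOnWith.of_dist_le_mul fun x hx y hy => ?_
    have hc' : ∀ t ∈ Icc a b, ‖f t‖ ≤ (c.toNNReal : ℝ) := fun t ht =>
      (hc t ht).trans (Real.le_coe_toNNReal c)
    rw [dist_eq_norm, Real.dist_eq]
    rcases le_total x y with hxy | hxy
    · rw [norm_sub_rev, abs_sub_comm, abs_of_nonneg (sub_nonneg.2 hxy)]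
      exact h.norm_sub_le hc' hx hy hxy
    · rw [abs_of_nonneg (sub_nonneg.2 hxy)]
      exact h.norm_sub_le hc' hy hx hxy
  exact hL.continuousOn

theorem mono (h : IsPrimitiveOn a b F f) {a' b' : ℝ} (ha : a ≤ a') (hb : b' ≤ b) :
    IsPrimitiveOn a' b' F f := by
  have hsub : Icc a' b' ⊆ Icc a b := Icc_subset_Icc ha hb
  obtain ⟨c, hc⟩ := h.bounded
  refine ⟨h.measurable.mono_set hsub, ⟨c, fun t ht => hc t (hsub ht)⟩, fun t ht => ?_⟩
  rw [← h.sub_eq (hsub ⟨le_rfl, ht.1.trans ht.2⟩) (hsub ht)]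
  abel

theorem const (a b : ℝ) (x : E) : IsPrimitiveOn a b (fun _ => x) (fun _ => 0) :=
  ⟨aestronglyMeasurable_const, ⟨0, by simp⟩, by simp⟩

theorem clm {E' : Type*} [NormedAddCommGroup E'] [NormedSpace ℝ E'] [CompleteSpace E]
    [CompleteSpace E'] (h : IsPrimitiveOn a b F f) (φ : E →L[ℝ] E') :
    IsPrimitiveOn a b (fun t => φ (F t)) (fun t => φ (f t)) := by
  obtain ⟨c, hc⟩ := h.bounded
  refine ⟨φ.continuous.comp_aestronglyMeasurable h.measurable, ⟨‖φ‖ * c, fun t ht => ?_⟩,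
    fun t ht => ?_⟩
  · exact φ.le_opNorm_of_le (hc t ht)
  · rw [φ.intervalIntegral_comp_comm (h.intervalIntegrable ⟨le_rfl, ht.1.trans ht.2⟩ ht),
      h.eq_add_integral t ht, map_add]

theorem eq_of_deriv_eq_zero (h : IsPrimitiveOn a b F f) (h0 : ∀ t ∈ Icc a b, f t = 0) :
    ∀ t ∈ Icc a b, F t = F a := by
  intro t ht
  have ha : a ∈ Icc a b := ⟨le_rfl, ht.1.trans ht.2⟩
  have := h.norm_sub_le (c := 0) (fun r hr => by simp [h0 r hr]) ha ht ht.1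
  simpa [sub_eq_zero] using this

end Space

section Algebra

variable {A : Type*} [NormedRing A] [NormedAlgebra ℝ A] [CompleteSpace A] {a b : ℝ}
  {F f G g : ℝ → A}

/-- Product rule without pointwise derivatives. Over `[s, t]` the increment of `F G` minus the
integral of `f G + F g` equals the integral of `f r (G t - G r) + (F s - F r) g r`. As `F` and `G`
are Lipschitz, this is of order `(t - s)²`, so the difference of the two sides is constant. -/
theorem mul (hF : IsPrimitiveOn a b F f) (hG : IsPrimitiveOn a b G g) :
    IsPrimitiveOn a b (fun t => F t * G t) (fun t => f t * G t + F t * g t) := by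
  have hmF := hF.continuousOn.aestronglyMeasurable (μ := volume) measurableSet_Icc
  have hmG := hG.continuousOn.aestronglyMeasurable (μ := volume) measurableSet_Icc
  obtain ⟨c₁, hc₁⟩ := hF.bounded
  obtain ⟨c₂, hc₂⟩ := hG.bounded
  obtain ⟨C₁, hC₁⟩ := isCompact_Icc.exists_bound_of_continuousOn hF.continuousOn
  obtain ⟨C₂, hC₂⟩ := isCompact_Icc.exists_bound_of_continuousOn hG.continuousOn
  have hm : AEStronglyMeasurable (fun t => f t * G t + F t * g t) (volume.restrict (Icc a b)) :=
    (hF.measurable.mul hmG).add (hmF.mul hG.measurable)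
  have hb : ∀ t ∈ Icc a b, ‖f t * G t + F t * g t‖ ≤ c₁ * C₂ + C₁ * c₂ := fun t ht =>
    (norm_add_le _ _).trans (add_le_add
      (norm_mul_le_of_le (hc₁ t ht) (hC₂ t ht)) (norm_mul_le_of_le (hC₁ t ht) (hc₂ t ht)))
  refine ⟨hm, ⟨_, hb⟩, ?_⟩
  have key := eq_of_norm_sub_le_sq (a := a) (b := b) (c := c₁ * c₂ + c₁ * c₂)
    (D := fun t => F t * G t - ∫ s in a..t, (f s * G s + F s * g s)) ?_
  · intro t ht
    have := key t ht
    simp only [intervalIntegral.integral_same, sub_zero] at this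
    exact sub_eq_iff_eq_add.1 this
  intro s hs t ht hst
  have hsub : Icc s t ⊆ Icc a b := Icc_subset_Icc hs.1 ht.2
  have ha : a ∈ Icc a b := ⟨le_rfl, hs.1.trans hs.2⟩
  have hi : ∀ x ∈ Icc a b, ∀ y ∈ Icc a b,
      IntervalIntegrable (fun r => f r * G r + F r * g r) volume x y :=
    fun x hx y hy => intervalIntegrable_of_bounded hm hb hx hy
  have hif := hF.intervalIntegrable hs ht
  have hig := hG.intervalIntegrable hs ht
  have e1 : (F t - F s) * G t = ∫ r in s..t, f r * G t := by
    rw [hF.sub_eq hs ht]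
    exact (((ContinuousLinearMap.mul ℝ A).flip (G t)).intervalIntegral_comp_comm hif).symm
  have e2 : F s * (G t - G s) = ∫ r in s..t, F s * g r := by
    rw [hG.sub_eq hs ht]
    exact ((ContinuousLinearMap.mul ℝ A (F s)).intervalIntegral_comp_comm hig).symm
  have i1 : IntervalIntegrable (fun r => f r * G t) volume s t :=
    intervalIntegrable_of_bounded (c := c₁ * ‖G t‖) (hF.measurable.mul_const _)
      (fun r hr => norm_mul_le_of_le (hc₁ r hr) le_rfl) hs ht
  have i2 : IntervalIntegrable (fun r => F s * g r) volume s t :=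
    intervalIntegrable_of_bounded (c := ‖F s‖ * c₂) (hG.measurable.const_mul _)
      (fun r hr => norm_mul_le_of_le le_rfl (hc₂ r hr)) hs ht
  have e : (F t * G t - ∫ s in a..t, (f s * G s + F s * g s)) -
      (F s * G s - ∫ r in a..s, (f r * G r + F r * g r)) =
      ∫ r in s..t, (f r * (G t - G r) + (F s - F r) * g r) := by
    have h3 : (∫ r in a..t, (f r * G r + F r * g r)) - (∫ r in a..s, (f r * G r + F r * g r)) =
        ∫ r in s..t, (f r * G r + F r * g r) :=
      intervalIntegral.integral_interval_sub_left (hi a ha t ht) (hi a ha s hs)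
    have h4 : (∫ r in s..t, (f r * (G t - G r) + (F s - F r) * g r)) =
        (∫ r in s..t, f r * G t) + (∫ r in s..t, F s * g r) -
          ∫ r in s..t, (f r * G r + F r * g r) := by
      rw [← intervalIntegral.integral_add i1 i2,
        ← intervalIntegral.integral_sub (i1.add i2) (hi s hs t ht)]
      congr 1
      ext r
      noncomm_ring
    rw [h4, ← e1, ← e2, ← h3]
    noncomm_ring
  rw [e]
  refine (intervalIntegral.norm_integral_le_of_norm_le_const
    (C := (c₁ * c₂ + c₁ * c₂) * (t - s)) fun r hr => ?_).trans ?_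
  · rw [uIoc_of_le hst] at hr
    have hr' : r ∈ Icc a b := hsub ⟨hr.1.le, hr.2⟩
    have hc0 : 0 ≤ c₁ := (norm_nonneg _).trans (hc₁ r hr')
    have hc0' : 0 ≤ c₂ := (norm_nonneg _).trans (hc₂ r hr')
    have n1 : ‖G t - G r‖ ≤ c₂ * (t - s) :=
      (hG.norm_sub_le hc₂ hr' ht hr.2).trans (by gcongr; exact hr.1.le)
    have n2 : ‖F s - F r‖ ≤ c₁ * (t - s) := by
      rw [norm_sub_rev]
      exact (hF.norm_sub_le hc₁ hs hr' hr.1.le).trans (by gcongr; exact hr.2)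
    calc _ ≤ c₁ * (c₂ * (t - s)) + c₁ * (t - s) * c₂ :=
          (norm_add_le _ _).trans (add_le_add (norm_mul_le_of_le (hc₁ r hr') n1)
            (norm_mul_le_of_le n2 (hc₂ r hr')))
      _ = _ := by ring
  · rw [abs_of_nonneg (sub_nonneg.2 hst)]
    exact le_of_eq (by ring)

theorem mul_const (hF : IsPrimitiveOn a b F f) (x : A) :
    IsPrimitiveOn a b (fun t => F t * x) (fun t => f t * x) := by
  simpa using hF.mul (const a b x)

end Algebra

end IsPrimitiveOn

/-! ### Skew-adjoint generators and their evolutions -/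

/-- A bounded, measurable, skew-adjoint generator on `[a, b]`. -/
structure IsSkewGenerator {A : Type*} [CStarAlgebra A] (a b η : ℝ) (G : ℝ → A) : Prop where
  measurable : AEStronglyMeasurable G (volume.restrict (Icc a b))
  star_eq : ∀ t ∈ Icc a b, star (G t) = -G t
  norm_le : ∀ t ∈ Icc a b, ‖G t‖ ≤ η

namespace IsSkewGenerator

variable {A : Type*} [CStarAlgebra A] {a b η : ℝ} {G U : ℝ → A}

theorem mono (h : IsSkewGenerator a b η G) {a' b' : ℝ} (ha : a ≤ a') (hb : b' ≤ b) :
    IsSkewGenerator a' b' η G :=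
  have hsub : Icc a' b' ⊆ Icc a b := Icc_subset_Icc ha hb
  ⟨h.measurable.mono_set hsub, fun t ht => h.star_eq t (hsub ht), fun t ht => h.norm_le t (hsub ht)⟩

theorem sum {K : ℕ} {G : Fin K → ℝ → A} (h : ∀ i, IsSkewGenerator a b η (G i)) :
    IsSkewGenerator a b (K * η) (fun t => ∑ i, G i t) where
  measurable := Finset.aestronglyMeasurable_fun_sum _ fun i _ => (h i).measurable
  star_eq t ht := by simp [star_sum, (h _).star_eq t ht]
  norm_le t ht := by
    simpa using norm_sum_le_of_le Finset.univ fun i _ => (h i).norm_le t ht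

theorem isPrimitiveOn (h : IsSkewGenerator a b η G) (hU : ContinuousOn U (Icc a b))
    (hint : ∀ t ∈ Icc a b, U t = 1 + ∫ s in a..t, G s * U s) :
    IsPrimitiveOn a b U (fun t => G t * U t) := by
  obtain ⟨c, hc⟩ := isCompact_Icc.exists_bound_of_continuousOn hU
  refine ⟨h.measurable.mul (hU.aestronglyMeasurable measurableSet_Icc),
    ⟨η * c, fun t ht => norm_mul_le_of_le (h.norm_le t ht) (hc t ht)⟩, fun t ht => ?_⟩
  rw [hint t ht, hint a ⟨le_rfl, ht.1.trans ht.2⟩]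
  simp

end IsSkewGenerator

theorem IntervalIntegrable.finset_sum {ι : Type*} {s : Finset ι} {f : ι → ℝ → ℝ} {a b : ℝ}
    (h : ∀ i, IntervalIntegrable (f i) volume a b) :
    IntervalIntegrable (fun t => ∑ i ∈ s, f i t) volume a b := by
  have := IntervalIntegrable.sum s (f := f) fun i _ => h i
  rwa [Finset.sum_fn] at this

section Evolution

variable {A : Type*} [CStarAlgebra A] {a b η : ℝ}

theorem IsPrimitiveOn.star {F f : ℝ → A} (h : IsPrimitiveOn a b F f) :
    IsPrimitiveOn a b (fun t => star (F t)) (fun t => star (f t)) :=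
  h.clm (starL' ℝ (A := A)).toContinuousLinearMap

/-- The derivative of `U* U` is `U* (G* + G) U = 0`. This makes `U` an isometry, and Dedekind
finiteness supplies `U U* = 1`. -/
theorem mem_unitary_of_isPrimitiveOn [IsDedekindFiniteMonoid A] {G U : ℝ → A}
    (hG : IsSkewGenerator a b η G) (hU : IsPrimitiveOn a b U (fun t => G t * U t))
    (ha : U a ∈ unitary A) : ∀ t ∈ Icc a b, U t ∈ unitary A := by
  intro t ht
  have h := (hU.star.mul hU).eq_of_deriv_eq_zero (fun s hs => by
    rw [star_mul, hG.star_eq s hs]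
    noncomm_ring) t ht
  rw [(Unitary.mem_iff.1 ha).1] at h
  exact Unitary.mem_iff.2 ⟨h, mul_eq_one_comm.1 h⟩

/-- The function `U* x U` has derivative `U* [x, G] U`, whose norm is that of `[x, G]` because `U`
is unitary. -/
theorem norm_commutator_le_integral [IsDedekindFiniteMonoid A] {G U : ℝ → A}
    (hG : IsSkewGenerator a b η G) (hU : IsPrimitiveOn a b U (fun t => G t * U t))
    (ha : U a = 1) (x : A) : ∀ t ∈ Icc a b,
      ‖x * U t - U t * x‖ ≤ ∫ s in a..t, ‖x * G s - G s * x‖ := by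
  intro t ht
  have ha' : a ∈ Icc a b := ⟨le_rfl, ht.1.trans ht.2⟩
  have hun := mem_unitary_of_isPrimitiveOn hG hU (ha ▸ one_mem _)
  have hmeas : AEStronglyMeasurable (fun s => x * G s - G s * x) (volume.restrict (Icc a b)) :=
    (hG.measurable.const_mul x).sub (hG.measurable.mul_const x)
  have hint : IntervalIntegrable (fun s => ‖x * G s - G s * x‖) volume a t :=
    (intervalIntegrable_of_bounded hmeas (c := ‖x‖ * η + η * ‖x‖) (fun s hs =>
      (norm_sub_le _ _).trans (add_le_add (norm_mul_le_of_le le_rfl (hG.norm_le s hs))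
        (norm_mul_le_of_le (hG.norm_le s hs) le_rfl))) ha' ht).norm
  have h := ((hU.star.mul_const x).mul hU).norm_sub_le_integral ha' ht ht.1 hint (fun s hs => by
    have hs' : s ∈ Icc a b := ⟨hs.1, hs.2.trans ht.2⟩
    have e : star (G s * U s) * x * U s + star (U s) * x * (G s * U s) =
        star (U s) * ((x * G s - G s * x) * U s) := by
      rw [star_mul, hG.star_eq s hs']
      noncomm_ring
    rw [e, CStarRing.norm_mem_unitary_mul _ (Unitary.star_mem (hun s hs')),
      CStarRing.norm_mul_mem_unitary _ (hun s hs')])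
  -- Left multiplication by the unitary `U t` turns `U* x U - x` into `x U - U x` without changing
  -- the norm.
  refine le_trans (le_of_eq ?_) h
  rw [ha, star_one, one_mul, mul_one,
    ← CStarRing.norm_mem_unitary_mul (star (U t) * x * U t - x) (hun t ht)]
  congr 1
  rw [mul_sub, ← mul_assoc, ← mul_assoc, (Unitary.mem_iff.1 (hun t ht)).2, one_mul]

/-- Induction on the number of factors: the product rule puts each generator next to its own factor,
and the commutators with the factors to its left are the price of moving it to the front. The other
factors are unitary and do not affect the norms. -/
theorem isPrimitiveOn_list_prod [IsDedekindFiniteMonoid A] :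
    ∀ {K : ℕ} {G u : Fin K → ℝ → A}, (∀ i, IsSkewGenerator a b η (G i)) →
      (∀ i, IsPrimitiveOn a b (u i) (fun t => G i t * u i t)) → (∀ i, u i a = 1) →
      ∃ v : ℝ → A, IsPrimitiveOn a b (fun t => (List.ofFn fun i => u i t).prod) v ∧
        (∀ t ∈ Icc a b, ‖v t - (∑ i, G i t) * (List.ofFn fun i => u i t).prod‖ ≤
          ∑ i, ∑ j, if i < j then ‖G j t * u i t - u i t * G j t‖ else 0)
  | 0, G, u, _, _, _ => ⟨fun _ => 0, by simpa using IsPrimitiveOn.const a b (1 : A), by simp⟩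
  | K + 1, G, u, hG, hu, h1 => by
    obtain ⟨v, hv, hle⟩ := isPrimitiveOn_list_prod (fun i => hG i.succ) (fun i => hu i.succ)
      (fun i => h1 i.succ)
    have hun := mem_unitary_of_isPrimitiveOn (hG 0) (hu 0) (h1 0 ▸ one_mem _)
    refine ⟨_, by simpa only [List.ofFn_succ, List.prod_cons] using (hu 0).mul hv, fun t ht => ?_⟩
    have hle := hle t ht
    set P := (List.ofFn fun i : Fin K => u i.succ t).prod with hP
    have hPu : P ∈ unitary A := by
      refine Submonoid.list_prod_mem _ fun x hx => ?_
      obtain ⟨i, rfl⟩ := (List.mem_ofFn' _ _).1 hx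
      exact mem_unitary_of_isPrimitiveOn (hG i.succ) (hu i.succ) (h1 i.succ ▸ one_mem _) t ht
    simp only [List.ofFn_succ, List.prod_cons, Fin.sum_univ_succ, ← hP]
    have e : G 0 t * u 0 t * P + u 0 t * v t - (G 0 t + ∑ i : Fin K, G i.succ t) * (u 0 t * P) =
        u 0 t * (v t - (∑ i : Fin K, G i.succ t) * P) -
          (∑ i : Fin K, (G i.succ t * u 0 t - u 0 t * G i.succ t)) * P := by
      rw [Finset.sum_sub_distrib, ← Finset.sum_mul, ← Finset.mul_sum]
      noncomm_ring
    rw [e]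
    refine (norm_sub_le _ _).trans ?_
    rw [CStarRing.norm_mem_unitary_mul _ (hun t ht), CStarRing.norm_mul_mem_unitary _ hPu, add_comm]
    refine add_le_add ?_ ?_
    · simpa using norm_sum_le (Finset.univ : Finset (Fin K))
        fun i => G i.succ t * u 0 t - u 0 t * G i.succ t
    · simpa using hle

/-- The distance between an evolution and an ordered product of evolutions that are generated by
the terms of the generator. -/
theorem norm_sub_list_prod_le_integral [IsDedekindFiniteMonoid A] {K : ℕ} {G u : Fin K → ℝ → A}
    {U : ℝ → A} (hab : a ≤ b) (hG : ∀ i, IsSkewGenerator a b η (G i))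
    (hu : ∀ i, IsPrimitiveOn a b (u i) (fun t => G i t * u i t)) (h1 : ∀ i, u i a = 1)
    (hU : IsPrimitiveOn a b U (fun t => (∑ i, G i t) * U t)) (ha : U a ∈ unitary A)
    {g : ℝ → ℝ} (hg : IntervalIntegrable g volume a b)
    (hle : ∀ t ∈ Icc a b,
      ∑ i, ∑ j, (if i < j then ‖G j t * u i t - u i t * G j t‖ else 0) ≤ g t) :
    ‖U b - (List.ofFn fun i => u i b).prod * U a‖ ≤ ∫ t in a..b, g t := by
  obtain ⟨v, hv, hvle⟩ := isPrimitiveOn_list_prod hG hu h1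
  have hS := IsSkewGenerator.sum hG
  have hun := mem_unitary_of_isPrimitiveOn hS hU ha
  have haI : a ∈ Icc a b := ⟨le_rfl, hab⟩
  have hbI : b ∈ Icc a b := ⟨hab, le_rfl⟩
  -- Interaction picture: in the derivative of `U* P` the terms with `∑ G_i` cancel, and only the
  -- defect of `P` remains.
  have h := (hU.star.mul hv).norm_sub_le_integral haI hbI hab hg (fun t ht => by
    have e : star ((∑ i, G i t) * U t) * (List.ofFn fun i => u i t).prod + star (U t) * v t =
        star (U t) * (v t - (∑ i, G i t) * (List.ofFn fun i => u i t).prod) := by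
      rw [star_mul, hS.star_eq t ht]
      noncomm_ring
    rw [e, CStarRing.norm_mem_unitary_mul _ (Unitary.star_mem (hun t ht))]
    exact (hvle t ht).trans (hle t ht))
  have hPa : (List.ofFn fun i => u i a).prod = 1 :=
    List.prod_eq_one fun x hx => by
      obtain ⟨i, rfl⟩ := (List.mem_ofFn' _ _).1 hx
      exact h1 i
  refine le_trans (le_of_eq ?_) h
  rw [hPa, mul_one, ← CStarRing.norm_mem_unitary_mul (_ - star (U a)) (hun b hbI),
    ← CStarRing.norm_mul_mem_unitary (U b * (_ - star (U a))) ha, norm_sub_rev]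
  congr 1
  rw [mul_sub, sub_mul, ← mul_assoc, (Unitary.mem_iff.1 (hun b hbI)).2, one_mul, mul_assoc (U b),
    (Unitary.mem_iff.1 ha).1, mul_one]

theorem sum_norm_commutator_le [IsDedekindFiniteMonoid A] {K z : ℕ} {G u : Fin K → ℝ → A}
    (hG : ∀ i, IsSkewGenerator a b η (G i))
    (hu : ∀ i, IsPrimitiveOn a b (u i) (fun t => G i t * u i t)) (h1 : ∀ i, u i a = 1)
    (hz : ∀ j, ∀ t ∈ Icc a b, ∀ s ∈ Icc a b, {i | ¬ Commute (G j t) (G i s)}.ncard ≤ z) :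
    ∀ t ∈ Icc a b, ∑ i, ∑ j, ‖G j t * u i t - u i t * G j t‖ ≤ K * z * (2 * η ^ 2) * (t - a) := by
  classical
  intro t ht
  have haI : a ∈ Icc a b := ⟨le_rfl, ht.1.trans ht.2⟩
  have bound : ∀ i j, ∀ s ∈ Icc a b, ‖G j t * G i s - G i s * G j t‖ ≤ 2 * η ^ 2 := by
    intro i j s hs
    refine (norm_sub_le _ _).trans ?_
    have h1 := norm_mul_le_of_le ((hG j).norm_le t ht) ((hG i).norm_le s hs)
    have h2 := norm_mul_le_of_le ((hG i).norm_le s hs) ((hG j).norm_le t ht)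
    linarith [sq η]
  have hint : ∀ i j, IntervalIntegrable (fun s => ‖G j t * G i s - G i s * G j t‖) volume a t :=
    fun i j => (intervalIntegrable_of_bounded (((hG i).measurable.const_mul _).sub
      ((hG i).measurable.mul_const _)) (bound i j) haI ht).norm
  rw [Finset.sum_comm]
  calc ∑ j, ∑ i, ‖G j t * u i t - u i t * G j t‖
      ≤ ∑ j : Fin K, z * (2 * η ^ 2) * (t - a) := Finset.sum_le_sum fun j _ => ?_
    _ = _ := by simp [mul_assoc]
  calc ∑ i, ‖G j t * u i t - u i t * G j t‖
      ≤ ∑ i, ∫ s in a..t, ‖G j t * G i s - G i s * G j t‖ :=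
        Finset.sum_le_sum fun i _ => norm_commutator_le_integral (hG i) (hu i) (h1 i) _ t ht
    -- The sum goes inside the integral before the nonzero terms are counted, since the set of
    -- noncommuting partners may change with `s`.
    _ = ∫ s in a..t, ∑ i, ‖G j t * G i s - G i s * G j t‖ :=
        (intervalIntegral.integral_finsetSum fun i _ => hint i j).symm
    _ ≤ ∫ s in a..t, z * (2 * η ^ 2) := by
        refine intervalIntegral.integral_mono_on ht.1 (IntervalIntegrable.finset_sum fun i => hint i j)
          (by simp) fun s hs => ?_
        have hs' : s ∈ Icc a b := ⟨hs.1, hs.2.trans ht.2⟩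
        rw [← Finset.sum_filter_of_ne (p := fun i => ¬ Commute (G j t) (G i s))]
        · refine (Finset.sum_le_card_nsmul _ _ _ fun i _ => bound i j s hs').trans ?_
          rw [nsmul_eq_mul]
          gcongr
          have := hz j t ht s hs'
          rwa [Set.ncard_eq_toFinset_card', Set.toFinset_ofPred] at this
        · intro i _ hi hc
          exact hi (by rw [hc.eq, sub_self, norm_zero])
    _ = z * (2 * η ^ 2) * (t - a) := by rw [intervalIntegral.integral_const, smul_eq_mul, mul_comm]

/-- The errors of the two opposite orderings in one Trotter step. -/
theorem norm_step_add_norm_step_rev_le [IsDedekindFiniteMonoid A] {K z : ℕ} {G u : Fin K → ℝ → A}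
    {U : ℝ → A} (hab : a ≤ b) (hG : ∀ i, IsSkewGenerator a b η (G i))
    (hu : ∀ i, IsPrimitiveOn a b (u i) (fun t => G i t * u i t)) (h1 : ∀ i, u i a = 1)
    (hz : ∀ j, ∀ t ∈ Icc a b, ∀ s ∈ Icc a b, {i | ¬ Commute (G j t) (G i s)}.ncard ≤ z)
    (hU : IsPrimitiveOn a b U (fun t => (∑ i, G i t) * U t)) (ha : U a ∈ unitary A) :
    ‖U b - (List.ofFn fun i => u i b).prod * U a‖ +
      ‖U b - (List.ofFn fun i => u (Fin.rev i) b).prod * U a‖ ≤ K * z * η ^ 2 * (b - a) ^ 2 := by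
  have haI : a ∈ Icc a b := ⟨le_rfl, hab⟩
  have hbI : b ∈ Icc a b := ⟨hab, le_rfl⟩
  have hint : ∀ i j, IntervalIntegrable (fun t => ‖G j t * u i t - u i t * G j t‖) volume a b := by
    intro i j
    have hc := (hu i).continuousOn
    have hm := hc.aestronglyMeasurable (μ := volume) measurableSet_Icc
    obtain ⟨C, hC⟩ := isCompact_Icc.exists_bound_of_continuousOn hc
    exact (intervalIntegrable_of_bounded (c := η * C + C * η)
      (((hG j).measurable.mul hm).sub (hm.mul (hG j).measurable))
      (fun t ht => (norm_sub_le _ _).trans (add_le_add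
        (norm_mul_le_of_le ((hG j).norm_le t ht) (hC t ht))
        (norm_mul_le_of_le (hC t ht) ((hG j).norm_le t ht)))) haI hbI).norm
  have hsum : ∀ p : Fin K → Fin K → Prop, ∀ _ : ∀ i j, Decidable (p i j),
      IntervalIntegrable (fun t => ∑ i, ∑ j,
        if p i j then ‖G j t * u i t - u i t * G j t‖ else 0) volume a b := by
    intro p _
    refine IntervalIntegrable.finset_sum fun i => IntervalIntegrable.finset_sum fun j => ?_
    by_cases h : p i j
    · simpa [h] using hint i j
    · simp [h]
  have hF := norm_sub_list_prod_le_integral hab hG hu h1 hU ha (hsum (fun i j => i < j) inferInstance)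
    fun t _ => le_rfl
  have hrev : ∀ t, ∑ i, G (Fin.rev i) t = ∑ i, G i t := fun t =>
    Equiv.sum_comp Fin.revPerm fun i => G i t
  -- Relabelling by `Fin.rev` turns the pairs `i < j` of the reversed product into the pairs `j < i`
  -- of the original one.
  have hR := norm_sub_list_prod_le_integral (G := fun i => G i.rev) (u := fun i => u i.rev) hab
    (fun i => hG i.rev) (fun i => hu i.rev) (fun i => h1 i.rev)
    (by simpa only [hrev] using hU) ha
    (hsum (fun i j => j < i) inferInstance) (fun t _ => le_of_eq (by
      rw [← Equiv.sum_comp Fin.revPerm]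
      refine Finset.sum_congr rfl fun i _ => ?_
      rw [← Equiv.sum_comp Fin.revPerm]
      simp))
  refine (add_le_add hF hR).trans ?_
  rw [← intervalIntegral.integral_add (hsum _ _) (hsum _ _)]
  calc _ ≤ ∫ t in a..b, K * z * (2 * η ^ 2) * (t - a) := by
        refine intervalIntegral.integral_mono_on hab ((hsum _ _).add (hsum _ _))
          (Continuous.intervalIntegrable (by fun_prop) _ _) fun t ht => ?_
        refine le_trans ?_ (sum_norm_commutator_le hG hu h1 hz t ht)
        rw [← Finset.sum_add_distrib]
        refine Finset.sum_le_sum fun i _ => ?_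
        rw [← Finset.sum_add_distrib]
        refine Finset.sum_le_sum fun j _ => ?_
        rcases lt_trichotomy i j with h | h | h
        · simp [h, h.not_gt]
        · simp [h]
        · simp [h, h.not_gt]
    _ = _ := by
        rw [intervalIntegral.integral_const_mul, intervalIntegral.integral_comp_sub_right (fun t => t)]
        simp
        ring

end Evolution

/-! ### Accumulation of errors in ordered products -/

theorem norm_list_ofFn_prod_le_one {A : Type*} [NormedRing A] [NormOneClass A] :
    ∀ {N : ℕ} {V : Fin N → A}, (∀ i, ‖V i‖ ≤ 1) →
    ‖(List.ofFn V).prod‖ ≤ 1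
  | 0, _, _ => by simp
  | N + 1, V, h => by
    rw [List.ofFn_succ, List.prod_cons]
    simpa using norm_mul_le_of_le (h 0) (norm_list_ofFn_prod_le_one fun i => h i.succ)

theorem norm_list_ofFn_prod_sub_le {A : Type*} [NormedRing A] [NormOneClass A] :
    ∀ {N : ℕ} {V W : Fin N → A}, (∀ i, ‖V i‖ ≤ 1) →
    (∀ i, ‖W i‖ ≤ 1) → ‖(List.ofFn V).prod - (List.ofFn W).prod‖ ≤ ∑ i, ‖V i - W i‖
  | 0, _, _, _, _ => by simp
  | N + 1, V, W, hV, hW => by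
    rw [List.ofFn_succ, List.prod_cons, List.ofFn_succ, List.prod_cons, Fin.sum_univ_succ]
    set P := (List.ofFn fun i : Fin N => V i.succ).prod
    set Q := (List.ofFn fun i : Fin N => W i.succ).prod
    have hP : ‖P‖ ≤ 1 := norm_list_ofFn_prod_le_one fun i => hV i.succ
    have hPQ : ‖P - Q‖ ≤ _ := norm_list_ofFn_prod_sub_le (fun i => hV i.succ) fun i => hW i.succ
    have e : V 0 * P - W 0 * Q = (V 0 - W 0) * P + W 0 * (P - Q) := by noncomm_ring
    rw [e]
    refine (norm_add_le _ _).trans (add_le_add ?_ ?_)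
    · simpa using norm_mul_le_of_le (le_refl ‖V 0 - W 0‖) hP
    · simpa using norm_mul_le_of_le (hW 0) hPQ

/-- Telescoping: the error of one step is propagated by the later factors, which are contractions
and do not enlarge it. -/
theorem norm_sub_list_ofFn_rev_prod_mul_le {A : Type*} [NormedRing A] :
    ∀ {N : ℕ} {V : Fin N → A} {x : ℕ → A},
    (∀ n, ‖V n‖ ≤ 1) → ‖x N - (List.ofFn fun n => V n.rev).prod * x 0‖ ≤
      ∑ n : Fin N, ‖x (n + 1) - V n * x n‖
  | 0, _, _, _ => by simp
  | N + 1, V, x, hV => by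
    have ih := norm_sub_list_ofFn_rev_prod_mul_le (V := fun n => V n.castSucc) (x := x)
      fun n => hV n.castSucc
    rw [List.ofFn_succ, List.prod_cons, Fin.sum_univ_castSucc, Fin.rev_zero, add_comm (Finset.sum _ _)]
    simp only [Fin.rev_succ, Fin.val_castSucc, Fin.val_last]
    set P := (List.ofFn fun n : Fin N => V n.rev.castSucc).prod
    have e : x (N + 1) - V (Fin.last N) * P * x 0 =
        (x (N + 1) - V (Fin.last N) * x N) + V (Fin.last N) * (x N - P * x 0) := by noncomm_ring
    rw [e]
    refine (norm_add_le _ _).trans (add_le_add le_rfl ?_)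
    simpa using norm_mul_le_of_le (hV (Fin.last N)) ih

/-- The errors of the Trotter products with the two opposite orderings of the factors. -/
theorem norm_trotter_add_norm_trotter_rev_le {A : Type*} [CStarAlgebra A] [Nontrivial A]
    [IsDedekindFiniteMonoid A] {K z N : ℕ} {T η : ℝ} {G : Fin K → ℝ → A}
    {U : ℝ → A} {u : Fin K → Fin N → ℝ → A} (hT : 0 ≤ T) (hN : 1 ≤ N)
    (hG : ∀ i, IsSkewGenerator 0 T η (G i))
    (hu : ∀ i (n : Fin N), IsPrimitiveOn ((n : ℕ) * (T / N)) (((n : ℕ) + 1) * (T / N)) (u i n)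
      (fun t => G i t * u i n t))
    (h1 : ∀ i (n : Fin N), u i n ((n : ℕ) * (T / N)) = 1)
    (hz : ∀ j, ∀ t ∈ Icc 0 T, ∀ s ∈ Icc 0 T, {i | ¬ Commute (G j t) (G i s)}.ncard ≤ z)
    (hU : IsPrimitiveOn 0 T U (fun t => (∑ i, G i t) * U t)) (hU0 : U 0 = 1) :
    ‖(List.ofFn fun n : Fin N => (List.ofFn fun i =>
        u i n.rev (((n.rev : ℕ) + 1) * (T / N))).prod).prod - U T‖ +
      ‖(List.ofFn fun n : Fin N => (List.ofFn fun i =>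
        u (Fin.rev i) n.rev (((n.rev : ℕ) + 1) * (T / N))).prod).prod - U T‖ ≤
      T / N * T * K * z * η ^ 2 := by
  have hN0 : (0 : ℝ) < N := by exact_mod_cast hN
  have hD : 0 ≤ T / N := by positivity
  have h0 : ∀ n : Fin N, (0 : ℝ) ≤ (n : ℕ) * (T / N) := fun n => by positivity
  have hle : ∀ n : Fin N, ((n : ℕ) : ℝ) * (T / N) ≤ ((n : ℕ) + 1) * (T / N) := fun n => by
    gcongr; linarith
  have hT' : ∀ n : Fin N, (((n : ℕ) : ℝ) + 1) * (T / N) ≤ T := fun n => by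
    have : ((n : ℕ) : ℝ) + 1 ≤ N := by exact_mod_cast n.2
    calc (((n : ℕ) : ℝ) + 1) * (T / N) ≤ N * (T / N) := by gcongr
      _ = T := by field_simp
  have hsub : ∀ n : Fin N, Icc ((n : ℕ) * (T / N)) (((n : ℕ) + 1) * (T / N)) ⊆ Icc 0 T :=
    fun n => Icc_subset_Icc (h0 n) (hT' n)
  have hGn : ∀ i (n : Fin N), IsSkewGenerator ((n : ℕ) * (T / N)) (((n : ℕ) + 1) * (T / N)) η
      (G i) := fun i n => (hG i).mono (h0 n) (hT' n)
  have hun : ∀ i (n : Fin N), ‖u i n (((n : ℕ) + 1) * (T / N))‖ ≤ 1 := fun i n =>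
    (CStarRing.norm_of_mem_unitary (mem_unitary_of_isPrimitiveOn (hGn i n) (hu i n)
      (h1 i n ▸ one_mem _) _ ⟨hle n, le_rfl⟩)).le
  have hUu := mem_unitary_of_isPrimitiveOn (IsSkewGenerator.sum hG) hU (hU0 ▸ one_mem _)
  have hstep := fun n : Fin N => norm_step_add_norm_step_rev_le (hle n) (fun i => hGn i n)
    (fun i => hu i n) (fun i => h1 i n)
    (fun j t ht s hs => hz j t (hsub n ht) s (hsub n hs)) (hU.mono (h0 n) (hT' n))
    (hUu _ (hsub n ⟨le_rfl, hle n⟩))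
  have hx0 : U (((0 : ℕ) : ℝ) * (T / N)) = 1 := by simp [hU0]
  have hxN : U ((N : ℝ) * (T / N)) = U T := by congr 1; field_simp
  have hF := norm_sub_list_ofFn_rev_prod_mul_le (x := fun n : ℕ => U (n * (T / N)))
    (V := fun n : Fin N => (List.ofFn fun i => u i n (((n : ℕ) + 1) * (T / N))).prod)
    fun n => norm_list_ofFn_prod_le_one fun i => hun i n
  have hR := norm_sub_list_ofFn_rev_prod_mul_le (x := fun n : ℕ => U (n * (T / N)))
    (V := fun n : Fin N => (List.ofFn fun i => u (Fin.rev i) n (((n : ℕ) + 1) * (T / N))).prod)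
    fun n => norm_list_ofFn_prod_le_one fun i => hun _ n
  simp only [hx0, hxN, mul_one, Nat.cast_add, Nat.cast_one] at hF hR
  rw [norm_sub_rev] at hF hR
  refine (add_le_add hF hR).trans ?_
  rw [← Finset.sum_add_distrib]
  refine (Finset.sum_le_sum fun n _ => hstep n).trans (le_of_eq ?_)
  have e : ∀ n : Fin N, (((n : ℕ) : ℝ) + 1) * (T / N) - (n : ℕ) * (T / N) = T / N := fun n => by ring
  simp only [e, Finset.sum_const, Finset.card_univ, Fintype.card_fin, nsmul_eq_mul]
  field_simp

/-! ### Existence of evolutions -/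

theorem isPrimitiveOn_integral {E : Type*} [NormedAddCommGroup E] [NormedSpace ℝ E] {a b c : ℝ}
    {f : ℝ → E} (hm : AEStronglyMeasurable f (volume.restrict (Icc a b)))
    (hc : ∀ t ∈ Icc a b, ‖f t‖ ≤ c) : IsPrimitiveOn a b (fun t => ∫ s in a..t, f s) f :=
  ⟨hm, ⟨c, hc⟩, by simp⟩

/-- A linear evolution equation with a bounded measurable generator has a solution. -/
theorem exists_evolution {A : Type*} [NormedRing A] [NormedAlgebra ℝ A] [CompleteSpace A]
    {a b η : ℝ} {G : ℝ → A} (hab : a ≤ b)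
    (hm : AEStronglyMeasurable G (volume.restrict (Icc a b))) (hη : ∀ t ∈ Icc a b, ‖G t‖ ≤ η) :
    ∃ U : ℝ → A, ContinuousOn U (Icc a b) ∧
      ∀ t ∈ Icc a b, U t = 1 + ∫ s in a..t, G s * U s := by
  have hη0 : 0 ≤ η := (norm_nonneg _).trans (hη a ⟨le_rfl, hab⟩)
  have ha : a ∈ Icc a b := ⟨le_rfl, hab⟩
  -- Picard iteration for the rescaled unknown `W t = exp (-l (t - a)) U t`. The weight makes the
  -- integral operator a contraction with factor `η / l ≤ 1 / 2` on the whole interval; the summand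
  -- `1` keeps `l` positive when `η = 0`.
  set l : ℝ := 2 * η + 1 with hl
  have hl0 : 0 < l := by positivity
  let f : C(Icc a b, A) → ℝ → A := fun W s => Real.exp (l * (s - a)) • (G s * IccExtend hab W s)
  have hcont : ∀ W : C(Icc a b, A), Continuous (IccExtend hab W) := fun W =>
    W.continuous.Icc_extend'
  have hfm : ∀ W, AEStronglyMeasurable (f W) (volume.restrict (Icc a b)) := fun W =>
    (Continuous.aestronglyMeasurable (by fun_prop)).smul
      (hm.mul (hcont W).aestronglyMeasurable)
  have hfb : ∀ W, ∀ t ∈ Icc a b, ‖f W t‖ ≤ Real.exp (l * (t - a)) * (η * ‖W‖) := by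
    intro W t ht
    rw [norm_smul, Real.norm_eq_abs, Real.abs_exp]
    gcongr
    exact norm_mul_le_of_le (hη t ht) (W.norm_coe_le_norm _)
  have hfb' : ∀ W, ∀ t ∈ Icc a b, ‖f W t‖ ≤ Real.exp (l * (b - a)) * (η * ‖W‖) := by
    intro W t ht
    refine (hfb W t ht).trans ?_
    gcongr
    exact ht.2
  have hfsub : ∀ W W' t, f W t - f W' t = f (W - W') t := by
    intro W W' t
    simp only [f, IccExtend, Function.comp_apply, ContinuousMap.sub_apply]
    rw [mul_sub (G t), smul_sub]
  have hprim := fun W => isPrimitiveOn_integral (hfm W) (hfb' W)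
  let Φ : C(Icc a b, A) → C(Icc a b, A) := fun W =>
    ⟨fun t => Real.exp (-(l * (t - a))) • (1 + ∫ s in a..t, f W s), by
      refine Continuous.smul (by fun_prop) (continuous_const.add ?_)
      exact (hprim W).continuousOn.domRestrict⟩
  have hΦ : ContractingWith (1 / 2) Φ := by
    refine ⟨by rw [← NNReal.coe_lt_coe]; norm_num, LipschitzWith.of_dist_le_mul fun W W' => ?_⟩
    rw [ContinuousMap.dist_le (by positivity)]
    intro t
    have hi := fun W => (hprim W).intervalIntegrable ha t.2
    have e : Φ W t - Φ W' t = Real.exp (-(l * (t - a))) • ∫ s in a..t, f (W - W') s := by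
      simp only [Φ, ContinuousMap.coe_mk]
      rw [← smul_sub, add_sub_add_left_eq_sub, ← intervalIntegral.integral_sub (hi W) (hi W')]
      simp only [hfsub]
    have hint : ∫ s in a..t, Real.exp (l * (s - a)) * (η * ‖W - W'‖) ≤
        Real.exp (l * (t - a)) * (1 / 2 * ‖W - W'‖) := by
      have h1 : ∫ s in a..t, Real.exp (l * (s - a)) = l⁻¹ * (Real.exp (l * (t - a)) - 1) := by
        have := intervalIntegral.integral_comp_mul_sub (a := a) (b := t) Real.exp hl0.ne' (l * a)
        simp only [mul_sub, this, sub_self, integral_exp, Real.exp_zero, smul_eq_mul]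
      rw [intervalIntegral.integral_mul_const, h1]
      have h2 : l⁻¹ * η ≤ 1 / 2 := by
        rw [inv_mul_le_iff₀ hl0, hl]; linarith
      calc l⁻¹ * (Real.exp (l * (t - a)) - 1) * (η * ‖W - W'‖)
          = (l⁻¹ * η) * (Real.exp (l * (t - a)) - 1) * ‖W - W'‖ := by ring
        _ ≤ (1 / 2) * Real.exp (l * (t - a)) * ‖W - W'‖ := by
            have : 0 ≤ Real.exp (l * (t - a)) - 1 :=
              sub_nonneg.2 (Real.one_le_exp (mul_nonneg hl0.le (sub_nonneg.2 t.2.1)))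
            gcongr
            linarith
        _ = _ := by ring
    rw [dist_eq_norm, dist_eq_norm, e, norm_smul, Real.norm_eq_abs, Real.abs_exp]
    have hn : ‖∫ s in a..t, f (W - W') s‖ ≤ ∫ s in a..t, Real.exp (l * (s - a)) * (η * ‖W - W'‖) :=
      intervalIntegral.norm_integral_le_of_norm_le t.2.1
        (Filter.Eventually.of_forall fun s hs => hfb _ s ⟨hs.1.le, hs.2.trans t.2.2⟩)
        (Continuous.intervalIntegrable (by fun_prop) _ _)
    calc Real.exp (-(l * (t - a))) * ‖∫ s in a..t, f (W - W') s‖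
        ≤ Real.exp (-(l * (t - a))) * (Real.exp (l * (t - a)) * (1 / 2 * ‖W - W'‖)) := by
          gcongr
          exact hn.trans hint
      _ = 1 / 2 * ‖W - W'‖ := by
          rw [← mul_assoc, ← Real.exp_add]; simp
      _ = _ := by simp
  set W := ContractingWith.fixedPoint Φ hΦ
  have hW : Φ W = W := hΦ.fixedPoint_isFixedPt
  refine ⟨fun t => Real.exp (l * (t - a)) • IccExtend hab W t,
    (Continuous.smul (by fun_prop) (hcont W)).continuousOn, fun t ht => ?_⟩
  have h1 : IccExtend hab W t = Real.exp (-(l * (t - a))) • (1 + ∫ s in a..t, f W s) := by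
    rw [IccExtend_of_mem hab W ht]
    conv_lhs => rw [← hW]
    rfl
  have h2 : ∀ s, G s * (Real.exp (l * (s - a)) • IccExtend hab W s) = f W s := fun s =>
    mul_smul_comm _ _ _
  simp only [h2]
  rw [h1, smul_smul, ← Real.exp_add]
  simp

/-! ### Nets in normed spaces and for unitary matrices -/

/-- The volume bound for a separated set in a ball of a normed space. -/
theorem card_le_of_separated_ball {E : Type*} [NormedAddCommGroup E] [NormedSpace ℝ E]
    [FiniteDimensional ℝ E] {R δ : ℝ} (hR : 0 ≤ R) (hδ : 0 < δ) (s : Finset E)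
    (hs : ∀ c ∈ s, ‖c‖ ≤ R) (h : ∀ c ∈ s, ∀ d ∈ s, c ≠ d → δ ≤ ‖c - d‖) :
    (s.card : ℝ) ≤ (1 + 2 * R / δ) ^ Module.finrank ℝ E := by
  borelize E
  let μ : Measure E := Measure.addHaar
  have hδ2 : 0 < δ / 2 := by positivity
  have hρ : 0 < R + δ / 2 := by positivity
  -- Balls of radius `δ / 2` about the points are disjoint and lie in the ball of radius `R + δ /
  -- 2`; volumes scale with the power `finrank`.
  have hD : (s : Set E).PairwiseDisjoint fun c => Metric.ball c (δ / 2) := by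
    intro c hc d hd hcd
    apply Metric.ball_disjoint_ball
    rw [dist_eq_norm, add_halves]
    exact h c hc d hd hcd
  have hsub : (⋃ c ∈ s, Metric.ball c (δ / 2)) ⊆ Metric.ball (0 : E) (R + δ / 2) := by
    refine iUnion₂_subset fun x hx => Metric.ball_subset_ball' ?_
    rw [dist_zero_right, add_comm]
    gcongr
    exact hs x hx
  have I : (s.card : ENNReal) * ENNReal.ofReal ((δ / 2) ^ Module.finrank ℝ E) * μ (Metric.ball 0 1) ≤
      ENNReal.ofReal ((R + δ / 2) ^ Module.finrank ℝ E) * μ (Metric.ball 0 1) := by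
    have := measure_mono (μ := μ) hsub
    rw [measure_biUnion_finset hD fun c _ => measurableSet_ball] at this
    simpa only [μ.addHaar_ball_of_pos _ hδ2, μ.addHaar_ball_of_pos _ hρ, Finset.sum_const,
      nsmul_eq_mul, mul_assoc] using this
  have J := (ENNReal.mul_le_mul_iff_left (Metric.measure_ball_pos μ _ zero_lt_one).ne'
    measure_ball_lt_top.ne).1 I
  have K := ENNReal.toReal_le_of_le_ofReal (pow_nonneg hρ.le _) J
  rw [ENNReal.toReal_mul, ENNReal.toReal_natCast, ENNReal.toReal_ofReal (by positivity)] at K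
  have e : 1 + 2 * R / δ = (R + δ / 2) / (δ / 2) := by field_simp; ring
  rw [e, div_pow, le_div_iff₀ (by positivity)]
  exact K

/-- A `δ`-separated subset of largest cardinality is a net, since a point farther than `δ` from it
could be added. The volume bound ensures that a largest one exists. -/
theorem exists_net_closedBall {E : Type*} [NormedAddCommGroup E] [NormedSpace ℝ E]
    [FiniteDimensional ℝ E] {R δ : ℝ} (hR : 0 ≤ R) (hδ : 0 < δ) :
    ∃ Q : Finset E, (Q.card : ℝ) ≤ (1 + 2 * R / δ) ^ Module.finrank ℝ E ∧
      ∀ x, ‖x‖ ≤ R → ∃ c ∈ Q, ‖x - c‖ ≤ δ := by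
  classical
  let P : ℕ → Prop := fun m => ∃ s : Finset E, s.card = m ∧ (∀ c ∈ s, ‖c‖ ≤ R) ∧
    ∀ c ∈ s, ∀ d ∈ s, c ≠ d → δ ≤ ‖c - d‖
  have hP : ∀ m, P m → m ≤ ⌊(1 + 2 * R / δ) ^ Module.finrank ℝ E⌋₊ := by
    rintro m ⟨s, rfl, h1, h2⟩
    exact Nat.le_floor (card_le_of_separated_ball hR hδ s h1 h2)
  have h0 : P 0 := ⟨∅, by simp⟩
  obtain ⟨s, hcard, h1, h2⟩ := Nat.findGreatest_spec (P := P) (Nat.zero_le _) h0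
  refine ⟨s, card_le_of_separated_ball hR hδ s h1 h2, fun x hx => ?_⟩
  by_contra! hfar
  have hxs : x ∉ s := fun hxs => by simpa using hδ.trans (hfar x hxs)
  have hins : P (s.card + 1) := by
    refine ⟨insert x s, Finset.card_insert_of_notMem hxs, ?_, ?_⟩
    · simpa [Finset.forall_mem_insert] using ⟨hx, h1⟩
    · intro c hc d hd hcd
      rcases Finset.mem_insert.1 hc with hc | hc <;> rcases Finset.mem_insert.1 hd with hd | hd
      · exact absurd (hc.trans hd.symm) hcd
      · exact hc ▸ (hfar d hd).le
      · rw [norm_sub_rev]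
        exact hd ▸ (hfar c hc).le
      · exact h2 c hc d hd hcd
  have := Nat.le_findGreatest (hP _ hins) hins
  rw [← hcard] at this
  omega

instance finite_selfAdjoint_matrix (n : Type*) [Fintype n] [DecidableEq n] :
    Module.Finite ℝ (selfAdjoint (Matrix n n ℂ)) :=
  Module.Finite.of_injective
    ({ toFun := Subtype.val, map_add' := fun _ _ => rfl, map_smul' := fun _ _ => rfl } :
      selfAdjoint (Matrix n n ℂ) →ₗ[ℝ] Matrix n n ℂ) Subtype.val_injective

instance finite_skewAdjoint_matrix (n : Type*) [Fintype n] [DecidableEq n] :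
    Module.Finite ℝ (skewAdjoint (Matrix n n ℂ)) :=
  Module.Finite.of_injective
    ({ toFun := Subtype.val, map_add' := fun _ _ => rfl, map_smul' := fun _ _ => rfl } :
      skewAdjoint (Matrix n n ℂ) →ₗ[ℝ] Matrix n n ℂ) Subtype.val_injective

/-- The matrices split into self-adjoint and skew-adjoint ones, and multiplication by `i` exchanges
the two parts, so each has half of the real dimension `2 n²`. -/
theorem finrank_selfAdjoint_matrix (n : Type*) [Fintype n] [DecidableEq n] :
    Module.finrank ℝ (selfAdjoint (Matrix n n ℂ)) = Fintype.card n ^ 2 := by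
  have e1 := (StarModule.decomposeProdAdjoint ℝ (Matrix n n ℂ)).finrank_eq
  have e2 : Module.finrank ℝ (skewAdjoint (Matrix n n ℂ)) =
      Module.finrank ℝ (selfAdjoint (Matrix n n ℂ)) := by
    let φ : selfAdjoint (Matrix n n ℂ) →ₗ[ℝ] skewAdjoint (Matrix n n ℂ) :=
      { toFun := fun x => ⟨Complex.I • x.1, x.2.smul_mem_skewAdjoint Complex.conj_I⟩
        map_add' := fun x y => by ext1; simp
        map_smul' := fun r x => by ext1; exact smul_comm _ _ _ }
    let ψ : skewAdjoint (Matrix n n ℂ) →ₗ[ℝ] selfAdjoint (Matrix n n ℂ) := skewAdjoint.negISMul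
    refine le_antisymm ?_ ?_
    · refine LinearMap.finrank_le_finrank_of_injective (f := ψ) fun x y h => ?_
      have := congrArg (fun z : selfAdjoint (Matrix n n ℂ) => Complex.I • (z : Matrix n n ℂ)) h
      ext1
      simpa [ψ, smul_smul] using this
    · refine LinearMap.finrank_le_finrank_of_injective (f := φ) fun x y h => ?_
      have := congrArg (fun z : skewAdjoint (Matrix n n ℂ) => Complex.I • (z : Matrix n n ℂ)) h
      ext1
      simpa [φ, smul_smul] using this
  have e3 : Module.finrank ℝ (Matrix n n ℂ) = 2 * Fintype.card n ^ 2 := by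
    rw [← Module.finrank_mul_finrank ℝ ℂ, Complex.finrank_real_complex, Module.finrank_matrix]
    simp [sq]
  rw [Module.finrank_prod, e2, e3] at e1
  omega

/-- The path `exp (r X) exp ((1 - r) Y)` joins `exp Y` to `exp X`; its derivative `exp (r X) (X - Y)
exp ((1 - r) Y)` has norm at most `‖X - Y‖` because the exponentials are unitary. -/
theorem norm_exp_I_smul_sub_le {A : Type*} [CStarAlgebra A] [Nontrivial A] {x y : A}
    (hx : IsSelfAdjoint x) (hy : IsSelfAdjoint y) :
    ‖NormedSpace.exp (Complex.I • x) - NormedSpace.exp (Complex.I • y)‖ ≤ ‖x - y‖ := by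
  have mem : ∀ z : A, IsSelfAdjoint z → ∀ r : ℝ,
      ‖NormedSpace.exp (r • (Complex.I • z))‖ ≤ 1 := fun z hz r => by
    have h1 : IsSelfAdjoint (r • z) := (IsSelfAdjoint.all r).smul hz
    have := CStarRing.norm_coe_unitary (selfAdjoint.expUnitary ⟨r • z, h1⟩)
    rw [selfAdjoint.expUnitary_coe] at this
    rw [smul_comm]
    exact this.le
  set X := Complex.I • x
  set Y := Complex.I • y
  have hX := fun r : ℝ => hasDerivAt_exp_smul_const (𝕂 := ℝ) X r
  have hY := fun r : ℝ => HasDerivAt.scomp (𝕜 := ℝ) (𝕜' := ℝ) r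
    (hasDerivAt_exp_smul_const' (𝕂 := ℝ) Y (1 - r)) ((hasDerivAt_id r).const_sub 1)
  have hd := fun r : ℝ => (hX r).mul (hY r)
  have := norm_image_sub_le_of_norm_deriv_le_segment_01' (C := ‖x - y‖)
    (f := fun r : ℝ => NormedSpace.exp (r • X) * NormedSpace.exp ((1 - r) • Y))
    (fun r _ => (hd r).hasDerivWithinAt) ?_
  · simpa using this
  · intro r _
    have e : NormedSpace.exp (r • X) * X * (NormedSpace.exp ∘ fun u : ℝ => u • Y) (1 - r) +
        NormedSpace.exp (r • X) * (-1 : ℝ) • (Y * NormedSpace.exp ((1 - r) • Y)) =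
        NormedSpace.exp (r • X) * (X - Y) * NormedSpace.exp ((1 - r) • Y) := by
      simp
      noncomm_ring
    have hn : ‖X - Y‖ = ‖x - y‖ := by rw [← smul_sub, norm_smul]; simp
    have := norm_mul_le_of_le (norm_mul_le_of_le (mem x hx r) hn.le) (mem y hy (1 - r))
    rw [← e] at this
    simpa using this

theorem exists_selfAdjoint_exp_eq {n : Type*} [Fintype n] [DecidableEq n] {u : Matrix n n ℂ}
    (hu : u ∈ unitary (Matrix n n ℂ)) :
    ∃ x : selfAdjoint (Matrix n n ℂ), ‖x‖ ≤ Real.pi ∧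
      NormedSpace.exp (Complex.I • (x : Matrix n n ℂ)) = u := by
  refine ⟨Unitary.argSelfAdjoint ⟨u, hu⟩, Unitary.norm_argSelfAdjoint_le_pi _, ?_⟩
  have hn : IsStarNormal u := isStarNormal_of_mem_unitary hu
  -- The branch cut of `arg` is harmless for the functional calculus, because the spectrum is
  -- finite.
  have : ContinuousOn Complex.arg (spectrum ℂ u) :=
    (Matrix.finite_spectrum u).continuousOn _
  rw [Unitary.argSelfAdjoint_coe, ← CFC.exp_eq_normedSpace_exp (𝕜 := ℂ),
    ← cfc_comp_smul .., ← cfc_comp' ..]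
  conv_rhs => rw [← cfc_id' ℂ (u : Matrix n n ℂ)]
  refine cfc_congr fun y hy => ?_
  have hy₁ : ‖y‖ = 1 := spectrum.norm_eq_one_of_unitary hu hy
  have : Complex.I * y.arg = Complex.log y :=
    Complex.ext (by simp [Complex.log_re, hy₁]) (by simp [Complex.log_im])
  have hy0 : y ≠ 0 := fun h => by simp [h] at hy₁
  simpa [← Complex.exp_eq_exp_ℂ, this] using Complex.exp_log hy0

/-- A net for the unitary matrices. Only accuracies below `1` are of interest, as the zero matrix is
at distance `1` from each of them. -/
theorem exists_net_unitary (n : Type*) [Fintype n] [DecidableEq n] [Nonempty n] {δ : ℝ}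
    (hδ : 0 < δ) (hδ1 : δ ≤ 1) : ∃ Q : Finset (Matrix n n ℂ),
      (Q.card : ℝ) ≤ (21 / 2 / δ) ^ (Fintype.card n ^ 2) ∧ (∀ c ∈ Q, ‖c‖ ≤ 1) ∧
        ∀ u ∈ unitary (Matrix n n ℂ), ∃ c ∈ Q, ‖u - c‖ ≤ δ := by
  classical
  obtain ⟨Q, hQ, hcov⟩ := exists_net_closedBall (E := selfAdjoint (Matrix n n ℂ))
    Real.pi_pos.le hδ
  refine ⟨Q.image fun x : selfAdjoint (Matrix n n ℂ) =>
    NormedSpace.exp (Complex.I • (x : Matrix n n ℂ)), ?_, ?_, ?_⟩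
  · refine (Nat.cast_le.2 Finset.card_image_le).trans (hQ.trans ?_)
    rw [finrank_selfAdjoint_matrix]
    gcongr
    -- The claim becomes `δ + 2 π ≤ 21 / 2`, which follows from `δ ≤ 1` and `π < 4`.
    rw [le_div_iff₀ hδ, add_mul, div_mul_cancel₀ _ hδ.ne']
    linarith [Real.pi_lt_four]
  · intro c hc
    obtain ⟨x, -, rfl⟩ := Finset.mem_image.1 hc
    exact (CStarRing.norm_coe_unitary (selfAdjoint.expUnitary x)).le
  · intro u hu
    obtain ⟨x, hx, rfl⟩ := exists_selfAdjoint_exp_eq hu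
    obtain ⟨c, hc, hxc⟩ := hcov x hx
    exact ⟨_, Finset.mem_image_of_mem _ hc, (norm_exp_I_smul_sub_le x.2 c.2).trans hxc⟩

/-! ### Operators supported on a set of sites -/

section Local

variable {d L : ℕ}

/-- The local factor is padded with the identity on the sites added to `S`. This lets supports of
fewer than `k` sites be placed inside the supports over which the covering is enumerated. -/
theorem ActsOn.mono {S S' : Finset (Fin L)} {A : QuditOp d L} (h : ActsOn S A) (hS : S ⊆ S') :
    ActsOn S' A := by
  classical
  obtain ⟨B, hB⟩ := h
  refine ⟨fun a b => if ∀ x : S', (x : Fin L) ∉ S → a x = b x then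
    B (fun x => a ⟨x, hS x.2⟩) (fun x => b ⟨x, hS x.2⟩) else 0, fun σ τ => ⟨fun h => ?_, fun h => ?_⟩⟩
  · beta_reduce
    split_ifs with h'
    · refine (hB σ τ).1 fun x hx => ?_
      by_cases hx' : x ∈ S'
      · exact h' ⟨x, hx'⟩ hx
      · exact h x hx'
    · exact (hB σ τ).2 fun h'' => h' fun x hx => h'' x hx
  · exact (hB σ τ).2 fun h'' => h fun x hx => h'' x fun hx' => hx (hS hx')

/-- A configuration, split into its parts on `S` and on the complement of `S`. -/
def splitConfig (d : ℕ) (S : Finset (Fin L)) :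
    (Fin L → Fin d) ≃ (S → Fin d) × ({x // x ∉ S} → Fin d) :=
  Equiv.piEquivPiSubtypeProd (fun x => x ∈ S) fun _ => Fin d

/-- The embedding `B ↦ B ⊗ 1` of the operators on the sites in `S`. -/
noncomputable def extendOp (d : ℕ) (S : Finset (Fin L)) :
    Matrix (S → Fin d) (S → Fin d) ℂ →⋆ₐ[ℂ] QuditOp d L where
  toFun B := (Matrix.kronecker B 1).submatrix (splitConfig d S) (splitConfig d S)
  map_one' := by
    change (Matrix.kroneckerMap (· * ·) _ _).submatrix _ _ = _
    rw [Matrix.one_kronecker_one, Matrix.submatrix_one_equiv]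
  map_mul' B C := by
    rw [Matrix.submatrix_mul_equiv]
    change (Matrix.kroneckerMap (· * ·) _ _).submatrix _ _ =
      Matrix.submatrix (Matrix.kroneckerMap (· * ·) _ _ * Matrix.kroneckerMap (· * ·) _ _) _ _
    rw [← Matrix.mul_kronecker_mul, mul_one]
  map_zero' := by
    change (Matrix.kroneckerMap (· * ·) _ _).submatrix _ _ = _
    rw [Matrix.zero_kronecker]
    rfl
  map_add' B C := by
    change (Matrix.kroneckerMap (· * ·) _ _).submatrix _ _ = _
    rw [Matrix.add_kronecker]
    rfl
  commutes' r := by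
    change (Matrix.kroneckerMap (· * ·) _ _).submatrix _ _ = _
    rw [Algebra.algebraMap_eq_smul_one, Algebra.algebraMap_eq_smul_one, Matrix.smul_kronecker,
      Matrix.one_kronecker_one, Matrix.submatrix_smul]
    simp
  map_star' B := by
    rw [Matrix.star_eq_conjTranspose, Matrix.star_eq_conjTranspose, Matrix.conjTranspose_submatrix]
    change (Matrix.kroneckerMap (· * ·) _ _).submatrix _ _ =
      (Matrix.kroneckerMap (· * ·) _ _)ᴴ.submatrix _ _
    rw [Matrix.conjTranspose_kronecker, Matrix.conjTranspose_one]

theorem extendOp_apply (S : Finset (Fin L)) (B : Matrix (S → Fin d) (S → Fin d) ℂ)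
    (σ τ : Fin L → Fin d) : extendOp d S B σ τ =
      B (fun x => σ x) (fun x => τ x) *
        (1 : Matrix ({x // x ∉ S} → Fin d) ({x // x ∉ S} → Fin d) ℂ) (fun x => σ x) (fun x => τ x) := rfl

theorem actsOn_iff_exists_extendOp {S : Finset (Fin L)} {A : QuditOp d L} :
    ActsOn S A ↔ ∃ B, A = extendOp d S B := by
  refine exists_congr fun B => ⟨fun h => ?_, fun h σ τ => ?_⟩
  · ext σ τ
    rw [extendOp_apply]
    by_cases hst : ∀ x, x ∉ S → σ x = τ x
    · rw [(h σ τ).1 hst]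
      have : (fun x : {x // x ∉ S} => σ x) = fun x : {x // x ∉ S} => τ x :=
        funext fun x => hst x x.2
      rw [this, Matrix.one_apply_eq, mul_one]
    · rw [(h σ τ).2 hst, Matrix.one_apply_ne, mul_zero]
      exact fun h => hst fun x hx => congrFun h ⟨x, hx⟩
  · rw [h, extendOp_apply]
    refine ⟨fun hst => ?_, fun hst => ?_⟩
    · have : (fun x : {x // x ∉ S} => σ x) = fun x : {x // x ∉ S} => τ x :=
        funext fun x => hst x x.2
      rw [this, Matrix.one_apply_eq, mul_one]
    · rw [Matrix.one_apply_ne, mul_zero]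
      exact fun h => hst fun x hx => congrFun h ⟨x, hx⟩

/-- The block of an operator that belongs to a fixed configuration on the complement of `S`. -/
def restrictOp (S : Finset (Fin L)) (c : {x // x ∉ S} → Fin d) (A : QuditOp d L) :
    Matrix (S → Fin d) (S → Fin d) ℂ :=
  A.submatrix (fun a => (splitConfig d S).symm (a, c)) (fun a => (splitConfig d S).symm (a, c))

theorem restrictOp_extendOp (S : Finset (Fin L)) (c : {x // x ∉ S} → Fin d)
    (B : Matrix (S → Fin d) (S → Fin d) ℂ) : restrictOp S c (extendOp d S B) = B := by
  ext a b
  change (Matrix.kronecker B (1 : Matrix ({x // x ∉ S} → Fin d) _ ℂ))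
    (splitConfig d S ((splitConfig d S).symm (a, c)))
    (splitConfig d S ((splitConfig d S).symm (b, c))) = B a b
  simp [Matrix.kronecker, Matrix.kroneckerMap_apply]

theorem continuous_restrictOp (S : Finset (Fin L)) (c : {x // x ∉ S} → Fin d) :
    Continuous (restrictOp S c : QuditOp d L → _) :=
  continuous_id.matrix_submatrix _ _

theorem extendOp_injective (hd : 1 ≤ d) (S : Finset (Fin L)) :
    Function.Injective (extendOp d S) :=
  Function.LeftInverse.injective (restrictOp_extendOp S fun _ => ⟨0, hd⟩)

theorem norm_extendOp (hd : 1 ≤ d) (S : Finset (Fin L)) (B : Matrix (S → Fin d) (S → Fin d) ℂ) :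
    ‖extendOp d S B‖ = ‖B‖ :=
  NonUnitalStarAlgHom.norm_map (extendOp d S) (extendOp_injective hd S) B

/-- The equation is solved in the matrix algebra of the sites in `S` and the solution is then
embedded, so locality holds by construction. The block at any fixed outside configuration `c`
recovers the local factor of the generator. -/
theorem exists_evolution_actsOn (hd : 1 ≤ d) {S : Finset (Fin L)} {a b η : ℝ}
    {G : ℝ → QuditOp d L} (hab : a ≤ b) (hG : IsSkewGenerator a b η G)
    (hS : ∀ t ∈ Icc a b, ActsOn S (G t)) :
    ∃ u : ℝ → QuditOp d L, IsPrimitiveOn a b u (fun t => G t * u t) ∧ u a = 1 ∧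
      ∀ t, ActsOn S (u t) := by
  let c : {x // x ∉ S} → Fin d := fun _ => ⟨0, hd⟩
  have hext : ∀ t ∈ Icc a b, extendOp d S (restrictOp S c (G t)) = G t := by
    intro t ht
    obtain ⟨B, hB⟩ := actsOn_iff_exists_extendOp.1 (hS t ht)
    rw [hB, restrictOp_extendOp]
  have hm : AEStronglyMeasurable (fun t => restrictOp S c (G t)) (volume.restrict (Icc a b)) :=
    (continuous_restrictOp S c).comp_aestronglyMeasurable hG.measurable
  have hb : ∀ t ∈ Icc a b, ‖restrictOp S c (G t)‖ ≤ η := by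
    intro t ht
    rw [← norm_extendOp hd, hext t ht]
    exact hG.norm_le t ht
  obtain ⟨w, hwc, hw⟩ := exists_evolution hab hm hb
  obtain ⟨C, hC⟩ := isCompact_Icc.exists_bound_of_continuousOn hwc
  let φ : Matrix (S → Fin d) (S → Fin d) ℂ →L[ℂ] QuditOp d L :=
    LinearMap.toContinuousLinearMap (extendOp d S).toAlgHom.toLinearMap
  have hφ : ∀ B, φ B = extendOp d S B := fun B => rfl
  refine ⟨fun t => extendOp d S (w t), hG.isPrimitiveOn (φ.continuous.comp_continuousOn hwc)
    fun t ht => ?_, ?_, fun t => actsOn_iff_exists_extendOp.2 ⟨_, rfl⟩⟩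
  · have hi : IntervalIntegrable (fun s => restrictOp S c (G s) * w s) volume a t :=
      intervalIntegrable_of_bounded (c := η * C)
        (hm.mul (hwc.aestronglyMeasurable measurableSet_Icc))
        (fun s hs => norm_mul_le_of_le (hb s hs) (hC s hs)) ⟨le_rfl, hab⟩ ht
    have := congrArg φ (hw t ht)
    rw [map_add, ← φ.intervalIntegral_comp_comm hi] at this
    simp only [hφ, map_one, map_mul] at this
    rw [this]
    congr 1
    refine intervalIntegral.integral_congr fun s hs => ?_
    rw [uIcc_of_le ht.1] at hs
    simp only [hext s ⟨hs.1, hs.2.trans ht.2⟩]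
  · have := hw a ⟨le_rfl, hab⟩
    rw [intervalIntegral.integral_same, add_zero] at this
    simp only [this, map_one]

/-- A net for the unitary operators on at most `k` given sites. -/
theorem exists_net_unitary_actsOn (hd : 1 ≤ d) {k : ℕ} {S : Finset (Fin L)} (hS : S.card ≤ k)
    {δ : ℝ} (hδ : 0 < δ) {b : ℝ} (hb1 : 1 ≤ b) (hb : 21 / 2 / δ ≤ b) :
    ∃ Q : Finset (QuditOp d L),
      (Q.card : ℝ) ≤ b ^ d ^ (2 * k) ∧ (∀ c ∈ Q, ‖c‖ ≤ 1) ∧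
        ∀ u ∈ unitary (QuditOp d L), ActsOn S u → ∃ c ∈ Q, ‖u - c‖ ≤ δ := by
  classical
  have : Nonempty (Fin d) := ⟨⟨0, hd⟩⟩
  rcases le_or_gt δ 1 with hδ1 | hδ1
  · obtain ⟨Q, hQ, hQ1, hcov⟩ := exists_net_unitary (S → Fin d) hδ hδ1
    refine ⟨Q.image (extendOp d S), ?_, ?_, ?_⟩
    · refine (Nat.cast_le.2 Finset.card_image_le).trans (hQ.trans ?_)
      refine (pow_le_pow_left₀ (by positivity) hb _).trans (pow_le_pow_right₀ hb1 ?_)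
      rw [Fintype.card_fun, Fintype.card_fin, Fintype.card_coe, ← pow_mul, mul_comm]
      exact Nat.pow_le_pow_right hd (Nat.mul_le_mul_left 2 hS)
    · intro c hc
      obtain ⟨B, hB, rfl⟩ := Finset.mem_image.1 hc
      rw [norm_extendOp hd]
      exact hQ1 B hB
    · intro u hu hSu
      obtain ⟨B, rfl⟩ := actsOn_iff_exists_extendOp.1 hSu
      have hB : B ∈ unitary (Matrix (S → Fin d) (S → Fin d) ℂ) := by
        rw [Unitary.mem_iff] at hu ⊢
        constructor <;> apply extendOp_injective hd S
        · rw [map_mul, map_star, map_one, hu.1]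
        · rw [map_mul, map_star, map_one, hu.2]
      obtain ⟨c, hc, hcB⟩ := hcov B hB
      refine ⟨_, Finset.mem_image_of_mem _ hc, ?_⟩
      rwa [← map_sub, norm_extendOp hd]
  -- For accuracy above `1` the zero operator alone is a net, as unitaries have norm `1`.
  · refine ⟨{0}, by simpa using one_le_pow₀ hb1, by simp, fun u hu _ => ⟨0, by simp, ?_⟩⟩
    rw [sub_zero, CStarRing.norm_of_mem_unitary hu]
    exact hδ1.le

end Local

/-! ### Trotter approximation of the evolved observables -/

section Covering

variable {d L K k z : ℕ} {hbar η T : ℝ}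

theorem nontrivial_quditOp (hd : 1 ≤ d) : Nontrivial (QuditOp d L) :=
  have : Nonempty (Fin d) := ⟨⟨0, hd⟩⟩
  inferInstance

namespace IsAdmissible

variable {h : Fin K → ℝ → QuditOp d L}

theorem isSkewGenerator (hh : IsAdmissible k z hbar η T h) (hbar0 : 0 < hbar) (i : Fin K) :
    IsSkewGenerator 0 T η fun t => (-Complex.I / (hbar : ℂ)) • h i t where
  measurable :=
    (continuous_const_smul (-Complex.I / (hbar : ℂ))).comp_aestronglyMeasurable (hh.measurable i)
  star_eq t ht := by
    rw [star_smul, (hh.hermitian i t ht).isSelfAdjoint.star_eq, ← neg_smul]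
    congr 1
    simp [neg_div]
  norm_le t ht := by
    have := hh.bounded i t ht
    rw [norm_smul]
    simpa [abs_of_pos hbar0, div_eq_inv_mul] using this

theorem ncard_le (hh : IsAdmissible k z hbar η T h) (j : Fin K) :
    ∀ t ∈ Icc 0 T, ∀ s ∈ Icc 0 T, {i | ¬ Commute ((-Complex.I / (hbar : ℂ)) • h j t)
      ((-Complex.I / (hbar : ℂ)) • h i s)}.ncard ≤ z := by
  intro t ht s hs
  refine le_trans (Set.ncard_le_ncard (fun i hi => ?_) (Set.toFinite _)) (hh.commute j t ht s hs)
  exact fun hc => hi ((hc.smul_left _).smul_right _)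

theorem isPrimitiveOn (hh : IsAdmissible k z hbar η T h) (hbar0 : 0 < hbar)
    {U : ℝ → QuditOp d L} (hU : IsEvolution hbar (fun t => ∑ i, h i t) 0 T U) :
    IsPrimitiveOn 0 T U fun t => (∑ i, (-Complex.I / (hbar : ℂ)) • h i t) * U t := by
  refine (IsSkewGenerator.sum fun i => hh.isSkewGenerator hbar0 i).isPrimitiveOn hU.1
    fun t ht => ?_
  simpa only [← Finset.smul_sum, smul_mul_assoc] using hU.2 t ht

end IsAdmissible

theorem IsEvolution.apply_left {H U : ℝ → QuditOp d L} {a b : ℝ}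
    (hU : IsEvolution hbar H a b U) (hab : a ≤ b) : U a = 1 := by
  simpa using hU.2 a ⟨le_rfl, hab⟩

theorem norm_trotterProduct_sub_le (hd : 1 ≤ d) (hbar0 : 0 < hbar) (hT : 0 ≤ T)
    {h : Fin K → ℝ → QuditOp d L} {U : ℝ → QuditOp d L} {N : ℕ} {u : Fin K → Fin N → ℝ → QuditOp d L}
    (hh : IsAdmissible k z hbar η T h) (hU : IsEvolution hbar (fun t => ∑ i, h i t) 0 T U)
    (hN : 1 ≤ N) (hu : ∀ (i : Fin K) (n : Fin N),
      IsEvolution hbar (h i) ((n : ℕ) * (T / N)) (((n : ℕ) + 1) * (T / N)) (u i n)) :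
    ‖trotterProduct (fun i n => u i n (((n : ℕ) + 1) * (T / N))) - U T‖ ≤
      T / N * T * K * z * η ^ 2 := by
  have := nontrivial_quditOp (L := L) hd
  have hN0 : (0 : ℝ) < N := by exact_mod_cast hN
  have hle : ∀ n : Fin N, ((n : ℕ) : ℝ) * (T / N) ≤ ((n : ℕ) + 1) * (T / N) := fun n => by
    gcongr; linarith
  have hT' : ∀ n : Fin N, (((n : ℕ) : ℝ) + 1) * (T / N) ≤ T := fun n => by
    have : ((n : ℕ) : ℝ) + 1 ≤ N := by exact_mod_cast n.2
    calc (((n : ℕ) : ℝ) + 1) * (T / N) ≤ N * (T / N) := by gcongr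
      _ = T := by field_simp
  refine le_trans (le_add_of_nonneg_right (norm_nonneg _))
    (norm_trotter_add_norm_trotter_rev_le (u := u) hT hN (fun i => hh.isSkewGenerator hbar0 i)
    (fun i n => ?_) (fun i n => (hu i n).apply_left (hle n)) hh.ncard_le
    (hh.isPrimitiveOn hbar0 hU) (hU.apply_left hT))
  refine ((hh.isSkewGenerator hbar0 i).mono (by positivity) (hT' n)).isPrimitiveOn (hu i n).1
    fun t ht => ?_
  simpa only [smul_mul_assoc] using (hu i n).2 t ht

/-- Each evolution is approximated by a product of local unitary operators. The error is half of
that of the Trotter product with a given order of the factors. -/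
theorem exists_trotterProduct_near (hd : 1 ≤ d) (hbar0 : 0 < hbar) (hT : 0 ≤ T)
    {h : Fin K → ℝ → QuditOp d L} {U : ℝ → QuditOp d L} {N : ℕ}
    (hh : IsAdmissible k z hbar η T h) (hU : IsEvolution hbar (fun t => ∑ i, h i t) 0 T U)
    (hN : 1 ≤ N) : ∃ (S : Fin K → Finset (Fin L)) (u : Fin K → Fin N → QuditOp d L),
      (∀ i, (S i).card ≤ k) ∧ (∀ i n, u i n ∈ unitary (QuditOp d L) ∧ ActsOn (S i) (u i n)) ∧
        ‖trotterProduct u - U T‖ ≤ T / N * T * K * z * η ^ 2 / 2 := by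
  have := nontrivial_quditOp (L := L) hd
  have hN0 : (0 : ℝ) < N := by exact_mod_cast hN
  have hle : ∀ n : Fin N, ((n : ℕ) : ℝ) * (T / N) ≤ ((n : ℕ) + 1) * (T / N) := fun n => by
    gcongr; linarith
  have hT' : ∀ n : Fin N, (((n : ℕ) : ℝ) + 1) * (T / N) ≤ T := fun n => by
    have : ((n : ℕ) : ℝ) + 1 ≤ N := by exact_mod_cast n.2
    calc (((n : ℕ) : ℝ) + 1) * (T / N) ≤ N * (T / N) := by gcongr
      _ = T := by field_simp
  have hG := fun i => hh.isSkewGenerator hbar0 i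
  have hGn := fun i (n : Fin N) => (hG i).mono (a' := (n : ℕ) * (T / N)) (by positivity) (hT' n)
  choose S hSk hS using hh.klocal
  have hloc : ∀ i, ∀ t ∈ Icc 0 T, ActsOn (S i) ((-Complex.I / (hbar : ℂ)) • h i t) := by
    intro i t ht
    obtain ⟨B, hB⟩ := actsOn_iff_exists_extendOp.1 (hS i t ht)
    exact actsOn_iff_exists_extendOp.2 ⟨(-Complex.I / (hbar : ℂ)) • B, by rw [map_smul, hB]⟩
  choose u hu hu1 huS using fun i (n : Fin N) => exists_evolution_actsOn hd (hle n) (hGn i n)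
    fun t ht => hloc i t ⟨le_trans (by positivity) ht.1, ht.2.trans (hT' n)⟩
  have huu := fun i (n : Fin N) => mem_unitary_of_isPrimitiveOn (hGn i n) (hu i n)
    (hu1 i n ▸ one_mem _) _ ⟨hle n, le_rfl⟩
  have key := norm_trotter_add_norm_trotter_rev_le (u := u) hT hN hG hu hu1 hh.ncard_le
    (hh.isPrimitiveOn hbar0 hU) (hU.apply_left hT)
  -- The better of the two orderings has at most half of the summed error. If it is the reversed
  -- one, supports and factors are relabelled by `Fin.rev`.
  rcases le_total ‖(List.ofFn fun n : Fin N => (List.ofFn fun i =>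
        u i n.rev (((n.rev : ℕ) + 1) * (T / N))).prod).prod - U T‖
      ‖(List.ofFn fun n : Fin N => (List.ofFn fun i =>
        u (Fin.rev i) n.rev (((n.rev : ℕ) + 1) * (T / N))).prod).prod - U T‖ with hc | hc
  · refine ⟨S, fun i n => u i n (((n : ℕ) + 1) * (T / N)), hSk,
      fun i n => ⟨huu i n, huS i n _⟩, ?_⟩
    rw [trotterProduct]
    linarith
  · refine ⟨fun i => S i.rev, fun i n => u i.rev n (((n : ℕ) + 1) * (T / N)), fun i => hSk _,
      fun i n => ⟨huu _ n, huS _ n _⟩, ?_⟩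
    rw [trotterProduct]
    linarith

theorem norm_trotterProduct_le_one (hd : 1 ≤ d) {N : ℕ} {u : Fin K → Fin N → QuditOp d L}
    (hu : ∀ i n, ‖u i n‖ ≤ 1) : ‖trotterProduct u‖ ≤ 1 :=
  have := nontrivial_quditOp (L := L) hd
  norm_list_ofFn_prod_le_one fun _ => norm_list_ofFn_prod_le_one fun _ => hu _ _

theorem norm_trotterProduct_sub_trotterProduct_le (hd : 1 ≤ d) {N : ℕ}
    {u v : Fin K → Fin N → QuditOp d L} {δ : ℝ} (hu : ∀ i n, ‖u i n‖ ≤ 1) (hv : ∀ i n, ‖v i n‖ ≤ 1)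
    (huv : ∀ i n, ‖u i n - v i n‖ ≤ δ) : ‖trotterProduct u - trotterProduct v‖ ≤ N * (K * δ) := by
  have := nontrivial_quditOp (L := L) hd
  refine (norm_list_ofFn_prod_sub_le (fun _ => norm_list_ofFn_prod_le_one fun _ => hu _ _)
    (fun _ => norm_list_ofFn_prod_le_one fun _ => hv _ _)).trans ?_
  refine (Finset.sum_le_card_nsmul _ _ (K * δ) fun n _ => ?_).trans (by simp)
  refine (norm_list_ofFn_prod_sub_le (fun _ => hu _ _) (fun _ => hv _ _)).trans ?_
  exact (Finset.sum_le_card_nsmul _ _ δ fun i _ => huv _ _).trans (by simp)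

/-- After the subtraction of the midpoint of its spectrum, the norm of an observable is its
spectral width. -/
theorem exists_norm_sub_smul_one_le {O : QuditOp d L} (hO : O.IsHermitian) :
    ∃ c : ℝ, ‖O - c • (1 : QuditOp d L)‖ ≤ spectralWidth O := by
  have hO' : IsSelfAdjoint O := hO.isSelfAdjoint
  refine ⟨(sSup (spectrum ℝ O) + sInf (spectrum ℝ O)) / 2, ?_⟩
  set c := (sSup (spectrum ℝ O) + sInf (spectrum ℝ O)) / 2 with hc
  have hfin : (spectrum ℝ O).Finite := O.finite_real_spectrum
  have e : O - c • (1 : QuditOp d L) = cfc (fun x : ℝ => x - c) O := by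
    rw [cfc_sub (fun x : ℝ => x) (fun _ => c) O, cfc_id' ℝ O, cfc_const c O,
      Algebra.algebraMap_eq_smul_one]
  have hw : 0 ≤ spectralWidth O := by
    have := Real.sInf_le_sSup _ hfin.bddBelow hfin.bddAbove
    rw [spectralWidth]
    linarith
  rw [e]
  refine norm_cfc_le hw fun x hx => ?_
  have h1 := le_csSup hfin.bddAbove hx
  have h2 := csInf_le hfin.bddBelow hx
  rw [Real.norm_eq_abs, abs_le, spectralWidth, hc]
  constructor <;> linarith

/-- `V` is only a contraction, since net points may fail to be unitary. The multiple of the identity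
is therefore added back by hand, while conjugation by the unitary `U` fixes it. -/
theorem norm_conj_sub_conj_le (hd : 1 ≤ d) {O U V : QuditOp d L} {c w : ℝ}
    (hc : ‖O - c • (1 : QuditOp d L)‖ ≤ w)
    (hU : U ∈ unitary (QuditOp d L)) (hV : ‖V‖ ≤ 1) :
    ‖Uᴴ * O * U - (Vᴴ * (O - c • (1 : QuditOp d L)) * V + c • (1 : QuditOp d L))‖ ≤
      2 * ‖V - U‖ * w := by
  have := nontrivial_quditOp (L := L) hd
  have hU1 : ‖star U‖ ≤ 1 := by rw [norm_star]; exact (CStarRing.norm_of_mem_unitary hU).le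
  rw [← Matrix.star_eq_conjTranspose, ← Matrix.star_eq_conjTranspose]
  set P := O - c • (1 : QuditOp d L) with hP
  have e : star U * O * U - (star V * P * V + c • (1 : QuditOp d L)) =
      star U * P * (U - V) + star (U - V) * P * V := by
    have hO : O = P + c • (1 : QuditOp d L) := by rw [hP, sub_add_cancel]
    have hUU : star U * (c • (1 : QuditOp d L)) * U = c • (1 : QuditOp d L) := by
      rw [mul_smul_comm, smul_mul_assoc, mul_one, (Unitary.mem_iff.1 hU).1]
    have : star U * O * U = star U * P * U + c • (1 : QuditOp d L) := by
      rw [hO, mul_add, add_mul, hUU]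
    rw [this, star_sub]
    noncomm_ring
  rw [e]
  have n1 := norm_mul_le_of_le (norm_mul_le_of_le hU1 hc) (norm_sub_rev U V).le
  have n2 := norm_mul_le_of_le (norm_mul_le_of_le
    ((norm_star (U - V)).trans (norm_sub_rev U V)).le hc) hV
  refine (norm_add_le _ _).trans ((add_le_add n1 n2).trans (le_of_eq ?_))
  ring

end Covering

/-! ### The number of balls -/

section Counting

variable {d L K k z : ℕ} {hbar η T : ℝ}

/-- Supports are enumerated by maps `Fin k → Fin L`, of which there are `L ^ k`. Unused arguments go
to the site `0`, which may enlarge the support but never beyond `k` sites. -/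
theorem exists_subset_image_univ (hL : 1 ≤ L) {S : Finset (Fin L)} (hS : S.card ≤ k) :
    ∃ g : Fin k → Fin L, S ⊆ Finset.univ.image g := by
  obtain ⟨e⟩ : Nonempty (S ↪ Fin k) := Function.Embedding.nonempty_of_card_le (by simpa using hS)
  refine ⟨Function.extend e Subtype.val fun _ => ⟨0, hL⟩, fun x hx => ?_⟩
  exact Finset.mem_image.2 ⟨e ⟨x, hx⟩, Finset.mem_univ _, e.injective.extend_apply _ _ ⟨x, hx⟩⟩

/-- A covering of the evolved observables from nets for the factors of the Trotter product. -/
theorem coveredByBalls_evolvedObservables (hd : 1 ≤ d) (hL : 1 ≤ L) (hbar0 : 0 < hbar)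
    (hT : 0 ≤ T) {O : QuditOp d L} (hO : O.IsHermitian) {N : ℕ} (hN : 1 ≤ N) {ε δ b : ℝ}
    (hδ : 0 < δ) (hb1 : 1 ≤ b) (hb : 21 / 2 / δ ≤ b)
    (herr : T / N * T * K * z * η ^ 2 / 2 + N * (K * δ) ≤ ε / 2) :
    CoveredByBalls (evolvedObservables K k z hbar η T O) (ε * spectralWidth O)
      ((L : ℝ) ^ (k * K) * b ^ (d ^ (2 * k) * (K * N))) := by
  classical
  have := nontrivial_quditOp (L := L) hd
  obtain ⟨c, hc⟩ := exists_norm_sub_smul_one_le hO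
  choose Q hQcard hQ1 hQ using fun g : Fin k → Fin L =>
    exists_net_unitary_actsOn hd (k := k) (S := Finset.univ.image g)
      (Finset.card_image_le.trans (by simp)) hδ hb1 hb
  -- The supports `f` are chosen once per term and not once per time step, so their number is `L ^
  -- (k K)` independently of `N`.
  let R : (Fin K → Fin k → Fin L) → Finset (Fin K → Fin N → QuditOp d L) := fun f =>
    Fintype.piFinset fun i => Fintype.piFinset fun _ => Q (f i)
  have hR : ∀ f, ((R f).card : ℝ) ≤ b ^ (d ^ (2 * k) * (K * N)) := by
    intro f
    simp only [R, Fintype.card_piFinset, Finset.prod_const, Finset.card_univ, Fintype.card_fin,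
      Nat.cast_prod, Nat.cast_pow]
    refine (Finset.prod_le_prod (g := fun _ => (b ^ d ^ (2 * k)) ^ N) (fun i _ => by positivity)
      fun i _ => pow_le_pow_left₀ (by positivity) (hQcard (f i)) N).trans (le_of_eq ?_)
    rw [Finset.prod_const, Finset.card_univ, Fintype.card_fin, ← pow_mul, ← pow_mul, mul_comm N K]
  refine ⟨Finset.univ.biUnion fun f => (R f).image fun v =>
    (trotterProduct v)ᴴ * (O - c • (1 : QuditOp d L)) * trotterProduct v + c • (1 : QuditOp d L),
    ?_, ?_⟩
  · calc _ ≤ ∑ f : Fin K → Fin k → Fin L, (((R f).card : ℕ) : ℝ) := by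
          rw [← Nat.cast_sum]
          exact Nat.cast_le.2 (Finset.card_biUnion_le.trans
            (Finset.sum_le_sum fun f _ => Finset.card_image_le))
      _ ≤ ∑ _f : Fin K → Fin k → Fin L, b ^ (d ^ (2 * k) * (K * N)) :=
          Finset.sum_le_sum fun f _ => hR f
      _ = _ := by simp [pow_mul]
  · rintro A ⟨h, U, hh, hU, rfl⟩
    obtain ⟨S, u, hSk, hu, hnear⟩ := exists_trotterProduct_near hd hbar0 hT hh hU hN
    choose f hf using fun i => exists_subset_image_univ hL (hSk i)
    choose v hv huv using fun i n => hQ (f i) (u i n) (hu i n).1 ((hu i n).2.mono (hf i))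
    have hv1 : ∀ i n, ‖v i n‖ ≤ 1 := fun i n => hQ1 _ _ (hv i n)
    have hu1 : ∀ i n, ‖u i n‖ ≤ 1 := fun i n => (CStarRing.norm_of_mem_unitary (hu i n).1).le
    refine ⟨_, Finset.mem_biUnion.2 ⟨f, Finset.mem_univ _, Finset.mem_image_of_mem _ (a := v) ?_⟩, ?_⟩
    · exact Fintype.mem_piFinset.2 fun i => Fintype.mem_piFinset.2 fun n => hv i n
    have hUT : U T ∈ unitary (QuditOp d L) :=
      mem_unitary_of_isPrimitiveOn (IsSkewGenerator.sum fun i => hh.isSkewGenerator hbar0 i)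
        (hh.isPrimitiveOn hbar0 hU) (hU.apply_left hT ▸ one_mem _) _ ⟨hT, le_rfl⟩
    refine (norm_conj_sub_conj_le hd hc hUT (norm_trotterProduct_le_one hd hv1)).trans ?_
    have hw : 0 ≤ spectralWidth O := (norm_nonneg _).trans hc
    have h1 := norm_trotterProduct_sub_trotterProduct_le hd hv1 hu1
      fun i n => (norm_sub_rev _ _).trans_le (huv i n)
    have h2 := norm_sub_le_norm_sub_add_norm_sub (trotterProduct v) (trotterProduct u) (U T)
    gcongr
    linarith

theorem CoveredByBalls.mono {X : Set (QuditOp d L)} {r B B' : ℝ} (h : CoveredByBalls X r B)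
    (hB : B ≤ B') : CoveredByBalls X r B' :=
  let ⟨Q, hQ, hX⟩ := h
  ⟨Q, hQ.trans hB, hX⟩

theorem coveredByBalls_of_one_le (hd : 1 ≤ d) (hL : 1 ≤ L) (hbar0 : 0 < hbar)
    (hT : 0 ≤ T) {ε : ℝ} (hε : 0 < ε) {O : QuditOp d L} (hO : O.IsHermitian)
    (h1 : ε ≤ 4 * T ^ 2 * K * z * η ^ 2) (h2 : ε ^ 2 ≤ 112 * T ^ 2 * K ^ 2 * z * η ^ 2) :
    CoveredByBalls (evolvedObservables K k z hbar η T O) (ε * spectralWidth O)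
      ((L : ℝ) ^ (k * K) *
        (112 * T ^ 2 * K ^ 2 * z * η ^ 2 / ε ^ 2) ^
          (4 * (d : ℝ) ^ (2 * k) * T ^ 2 * K ^ 2 * z * η ^ 2 / ε)) := by
  have hK : (0 : ℝ) < K := by
    rcases Nat.eq_zero_or_pos K with rfl | hK
    · simp at h1; linarith
    · exact_mod_cast hK
  set x : ℝ := 4 * T ^ 2 * K * z * η ^ 2 / ε with hx
  have hx1 : 1 ≤ x := by rwa [hx, le_div_iff₀ hε, one_mul]
  have hx0 : 0 < x := by linarith
  have hxε : x * ε = 4 * T ^ 2 * K * z * η ^ 2 := by rw [hx, div_mul_cancel₀ _ hε.ne']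
  set b : ℝ := 112 * T ^ 2 * K ^ 2 * z * η ^ 2 / ε ^ 2 with hb
  have hb1 : 1 ≤ b := by rwa [hb, le_div_iff₀ (by positivity), one_mul]
  have hbx : b = 28 * x * K / ε := by
    rw [hb, hx]
    field_simp
    ring
  -- The error estimate below needs an integer `N` with `x / 3 ≤ N ≤ x`; for `x ≥ 1` this choice
  -- qualifies. The upper bound `N ≤ x` gives the exponent.
  set N : ℕ := ⌈x / 2⌉₊ with hNdef
  have hN0 : 0 < N := Nat.ceil_pos.2 (by positivity)
  have hNx : x / 2 ≤ N := Nat.le_ceil _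
  have hN1 : (1 : ℝ) ≤ N := by exact_mod_cast hN0
  have hNx' : (N : ℝ) ≤ x := by
    rcases le_or_gt x 2 with h | h
    · have : N ≤ 1 := Nat.ceil_le.2 (by push_cast; linarith)
      have : (N : ℝ) ≤ 1 := by exact_mod_cast this
      linarith
    · have := Nat.ceil_lt_add_one (a := x / 2) (by positivity)
      rw [← hNdef] at this
      linarith
  have hNpos : (0 : ℝ) < N := by linarith
  -- This `δ` makes the net base `21 / (2 δ)` equal to `28 x K / ε = b`, and it uses up the whole
  -- error budget when `N = x`: `ε / 8` for Trotter and `3 ε / 8` for the nets.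
  refine (coveredByBalls_evolvedObservables hd hL hbar0 hT hO hN0 (δ := 3 * ε / (8 * x * K))
    (b := b) (by positivity) hb1 (le_of_eq ?_) ?_).mono ?_
  · rw [hbx]
    field_simp
    norm_num
  · have e1 : T / N * T * K * z * η ^ 2 / 2 = x * ε / (8 * N) := by
      rw [hxε]
      field_simp
      ring
    have e2 : N * (K * (3 * ε / (8 * x * K))) = 3 * ε * N / (8 * x) := by field_simp
    rw [e1, e2, div_add_div _ _ (by positivity) (by positivity), div_le_div_iff₀ (by positivity)
      (by norm_num)]
    -- The condition `x ε / (8 N) + 3 ε N / (8 x) ≤ ε / 2` is quadratic in `N / x` with roots `1 /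
    -- 3` and `1`.
    have : 0 ≤ ε * ((x - N) * (3 * N - x)) :=
      mul_nonneg hε.le (mul_nonneg (by linarith) (by linarith))
    nlinarith
  · gcongr
    rw [← Real.rpow_natCast]
    refine Real.rpow_le_rpow_of_exponent_le hb1 ?_
    have e : 4 * (d : ℝ) ^ (2 * k) * T ^ 2 * K ^ 2 * z * η ^ 2 / ε = d ^ (2 * k) * (K * x) := by
      rw [hx]
      ring
    rw [e]
    push_cast
    gcongr

theorem coveredByBalls_of_lt (hd : 1 ≤ d) (hL : 1 ≤ L) (hbar0 : 0 < hbar)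
    (hT : 0 ≤ T) {ε : ℝ} (hε : 0 < ε) {O : QuditOp d L} (hO : O.IsHermitian)
    (h1 : 4 * T ^ 2 * K * z * η ^ 2 < ε) (h2 : ε ≤ 28 * K) :
    CoveredByBalls (evolvedObservables K k z hbar η T O) (ε * spectralWidth O)
      ((L : ℝ) ^ (k * K) * (28 * K / ε) ^ (d ^ (2 * k) * K)) := by
  have hK : (0 : ℝ) < K := by linarith
  -- A single time step suffices: the Trotter error is below `ε / 8`, and the nets contribute `3 ε /
  -- 8`.
  have := coveredByBalls_evolvedObservables (K := K) (k := k) (z := z) (η := η) (ε := ε) hd hL hbar0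
    hT hO le_rfl
    (δ := 3 * ε / (8 * K)) (b := 28 * K / ε) (by positivity)
    (by rwa [le_div_iff₀ hε, one_mul]) (le_of_eq (by field_simp; norm_num)) (by
      have : (K : ℝ) * (3 * ε / (8 * K)) = 3 * ε / 8 := by field_simp
      rw [this]
      push_cast
      nlinarith)
  simpa using this

/-- The growth of the number of balls. -/
theorem exists_const_rpow_le_exp (d k : ℕ) {η ε : ℝ} (hη : 0 ≤ η) (hε : 0 < ε) :
    ∃ C : ℝ, 0 < C ∧ ∀ y : ℝ, 2 ≤ y →
      (112 * y * η ^ 2 / ε ^ 2) ^ (4 * (d : ℝ) ^ (2 * k) * y * η ^ 2 / ε) ≤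
        Real.exp (C * (y * Real.log y)) := by
  set q : ℝ := 112 * η ^ 2 / ε ^ 2 with hq
  set D : ℝ := 4 * (d : ℝ) ^ (2 * k) * η ^ 2 / ε with hD
  have hD0 : 0 ≤ D := by positivity
  have hl2 : 0 < Real.log 2 := Real.log_pos (by norm_num)
  -- With base `q y` and exponent `D y`, the constant `log q` is absorbed into `log y ≥ log 2`. The
  -- final `+ 1` only keeps the constant positive when `D = 0`.
  refine ⟨D * (|Real.log q| / Real.log 2 + 1) + 1, by positivity, fun y hy => ?_⟩
  have hy0 : 0 < y := by linarith
  have hly : Real.log 2 ≤ Real.log y := Real.log_le_log (by norm_num) hy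
  have hly0 : 0 < Real.log y := hl2.trans_le hly
  rcases hη.eq_or_lt with rfl | hη0
  · simp only [ne_eq, OfNat.ofNat_ne_zero, not_false_eq_true, zero_pow, mul_zero, zero_div,
      Real.rpow_zero]
    exact Real.one_le_exp (by positivity)
  have hq0 : 0 < q := by positivity
  have e1 : 112 * y * η ^ 2 / ε ^ 2 = q * y := by rw [hq]; ring
  have e2 : 4 * (d : ℝ) ^ (2 * k) * y * η ^ 2 / ε = D * y := by rw [hD]; ring
  rw [e1, e2, Real.rpow_def_of_pos (by positivity), Real.log_mul hq0.ne' hy0.ne']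
  refine Real.exp_le_exp.2 ?_
  have h1 : Real.log q ≤ |Real.log q| / Real.log 2 * Real.log y := by
    calc Real.log q ≤ |Real.log q| / Real.log 2 * Real.log 2 := by
          rw [div_mul_cancel₀ _ hl2.ne']
          exact le_abs_self _
      _ ≤ _ := by gcongr
  calc (Real.log q + Real.log y) * (D * y)
      ≤ (|Real.log q| / Real.log 2 * Real.log y + Real.log y) * (D * y) := by gcongr
    _ ≤ (|Real.log q| / Real.log 2 * Real.log y + Real.log y) * (D * y) + y * Real.log y :=
        le_add_of_nonneg_right (by positivity)
    _ = _ := by ring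

end Counting

theorem mainTheorem3 (d k : ℕ) (hd : 1 ≤ d) (η ε : ℝ) (hη : 0 ≤ η) (hε : 0 < ε) :
    ∃ C : ℝ, 0 < C ∧
      ∀ (L K z : ℕ) (hbar T : ℝ), 1 ≤ L → 0 < hbar → 0 ≤ T →
        -- the number of balls, with at least one time step `4 T² K z η² / ε`
        (∀ O : QuditOp d L, O.IsHermitian →
          ε ≤ 4 * T ^ 2 * K * z * η ^ 2 → ε ^ 2 ≤ 112 * T ^ 2 * K ^ 2 * z * η ^ 2 →
          CoveredByBalls (evolvedObservables K k z hbar η T O) (ε * spectralWidth O)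
            ((L : ℝ) ^ (k * K) *
              (112 * T ^ 2 * K ^ 2 * z * η ^ 2 / ε ^ 2) ^
                (4 * (d : ℝ) ^ (2 * k) * T ^ 2 * K ^ 2 * z * η ^ 2 / ε))) ∧
        -- its growth, with a constant that depends on `d`, `k`, `η`, `ε` only
        (2 ≤ T ^ 2 * K ^ 2 * z →
          (L : ℝ) ^ (k * K) *
              (112 * T ^ 2 * K ^ 2 * z * η ^ 2 / ε ^ 2) ^
                (4 * (d : ℝ) ^ (2 * k) * T ^ 2 * K ^ 2 * z * η ^ 2 / ε) ≤
            (L : ℝ) ^ (k * K) *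
              Real.exp (C * ((T ^ 2 * K ^ 2 * z) * Real.log (T ^ 2 * K ^ 2 * z)))) ∧
        -- the number of balls for short times
        (∀ O : QuditOp d L, O.IsHermitian →
          4 * T ^ 2 * K * z * η ^ 2 < ε → ε ≤ 28 * K →
          CoveredByBalls (evolvedObservables K k z hbar η T O) (ε * spectralWidth O)
            ((L : ℝ) ^ (k * K) * (28 * K / ε) ^ (d ^ (2 * k) * K))) ∧
        -- the error of the Trotter-Suzuki decomposition into `N` steps of size `T / N`
        (∀ (h : Fin K → ℝ → QuditOp d L) (U : ℝ → QuditOp d L) (N : ℕ)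
          (u : Fin K → Fin N → ℝ → QuditOp d L),
          IsAdmissible k z hbar η T h →
          IsEvolution hbar (fun t => ∑ i, h i t) 0 T U → 1 ≤ N →
          (∀ (i : Fin K) (n : Fin N),
            IsEvolution hbar (h i) ((n : ℕ) * (T / N)) (((n : ℕ) + 1) * (T / N)) (u i n)) →
          ‖trotterProduct (fun i n => u i n (((n : ℕ) + 1) * (T / N))) - U T‖ ≤
            T / N * T * K * z * η ^ 2) := by
  obtain ⟨C, hC, hle⟩ := exists_const_rpow_le_exp d k hη hε
  refine ⟨C, hC, fun L K z hbar T hL hbar0 hT => ⟨fun O hO h1 h2 =>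
    coveredByBalls_of_one_le hd hL hbar0 hT hε hO h1 h2, fun hy => ?_, fun O hO h1 h2 =>
    coveredByBalls_of_lt hd hL hbar0 hT hε hO h1 h2, fun h U N u hh hU hN hu =>
    norm_trotterProduct_sub_le hd hbar0 hT hh hU hN hu⟩⟩
  gcongr
  refine le_trans (le_of_eq ?_) (hle _ hy)
  congr 1 <;> ring
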